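/- Let $\mathbb H^n$ be real hyperbolic $n$-space and let $X\subset\mathbb H^n$ be a finite nonempty set. Its quasi-convex hull is $Q(X)=\bigcup_{x,y\in X}[xy]$, the union of the geodesic segments (the edges of $Q(X)$) between points of $X$, with the metric of $\mathbb H^n$. A map $f:Y\to Z$ of metric spaces is an $(L,A)$-quasi-isometry if there is $\bar f:Z\to Y$ such that $\frac1L d-A\le d(f(\cdot),f(\cdot))\le L\,d+A$ on $Y$, the same holds for $\bar f$ on $Z$, and $d(y,\bar f f(y))\le A$, $d(z,f\bar f(z))\le A$ for all $y\in Y$, $z\in Z$. Put $\delta=\ln 3$. For $c>0$ with $|X|\le 2^c+2$, a Gromov approximating tree for $X$ is a finite metric tree $T$ with a map $p$ from $X$ to the vertices of $T$ such that every leaf of $T$ lies in $p(X)$ and $d(x_1,x_2)-2c\delta\le d(p(x_1),p(x_2))\le d(x_1,x_2)$ for all $x_1,x_2\in X$. For $x_1,x_2,x_3\in X$ let $\Delta=[x_1x_2x_3]$ be the (possibly degenerate) triangle, i.e. the union of its three sides, and let $\chi_\Delta$ be the map from $\Delta$ to its comparison tripod which is isometric on each side. For $i\ne j$ let $o_{ij}\in[x_ix_j]$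 be the point which $\chi_\Delta$ sends to the branch point of the tripod, and let $o\in T$ be the common point of the three segments $[p(x_i)p(x_j)]$. Denote by $p_\Delta:\Delta\to T$ the map, if it exists, with $p_\Delta(x_i)=p(x_i)$ and $p_\Delta(o_{ij})=o$ which maps each segment $[x_io_{ij}]$ to $[p(x_i)o]$ as a dilation, $d(p(x_i),p_\Delta(x))=\frac{d(p(x_i),o)}{d(x_i,o_{ij})}\,d(x_i,x)$. (1) There is a finite metric tree $T$ with a map $p:X\to T$ such that, for every $c>0$ with $|X|\le 2^c+2$, $(T,p)$ is a Gromov approximating tree for $X$ and there is a $(1,A)$-quasi-isometry $Q(X)\to T$ with $A=(20c+12)\ln 3$. (2) Let $c>0$ with $|X|\le 2^c+2$, let $(T,p)$ be any Gromov approximating tree for $X$, and let $e$ be an edge of $Q(X)$. Then there is a map $P_e:Q(X)\to T$ such that: $P_e$ is continuous on $e$; for every $x\in Q(X)$ there is a triangle $\Delta_x$ with vertices in $X$ such that $x\in\Delta_x$, the map $p_{\Delta_x}$ exists and $P_e(x)=p_{\Delta_x}(x)$, and the vertices of $\Delta_x$ are non-collinear whenever $X$ contains three non-collinear points; $P_e$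 extends $p$; every vertex of $T$ lies in the image of $P_e$; and $P_e$ is a $(1,(20c+12)\ln 3)$-quasi-isometry from $Q(X)$ to $T$. -/

import Mathlib

universe u

/-! ### Real hyperbolic space -/

/-- Real hyperbolic `n`-space `ℍⁿ` (hyperboloid model): the points `(time, space)` of `ℝ × ℝⁿ` with
`time > 0` and `time² - ‖space‖² = 1`. -/
@[ext]
structure HyperbolicSpace (n : ℕ) where
  time : ℝ
  space : EuclideanSpace ℝ (Fin n)
  time_pos : 0 < time
  time_sq : time ^ 2 = 1 + ‖space‖ ^ 2

namespace HyperbolicSpace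

variable {n : ℕ}

/-- Minus the Lorentz product of two points of the hyperboloid. -/
noncomputable def form (x y : HyperbolicSpace n) : ℝ :=
  x.time * y.time - inner ℝ x.space y.space

theorem form_comm (x y : HyperbolicSpace n) : form x y = form y x := by
  unfold form
  rw [real_inner_comm, mul_comm]

theorem form_self (x : HyperbolicSpace n) : form x x = 1 := by
  unfold form
  rw [real_inner_self_eq_norm_sq]
  nlinarith [x.time_sq]

/-- The Lorentz form is positive definite on the orthogonal complement of a point. -/
theorem norm_sq_le_of_orthogonal (v : HyperbolicSpace n) (z₀ : ℝ) (z : EuclideanSpace ℝ (Fin n))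
    (h : z₀ * v.time = inner ℝ z v.space) : ‖z‖ ^ 2 ≤ (‖z‖ ^ 2 - z₀ ^ 2) * v.time ^ 2 := by
  have h1 : (inner ℝ z v.space) ^ 2 ≤ ‖z‖ ^ 2 * ‖v.space‖ ^ 2 := by
    have h2 := abs_real_inner_le_norm z v.space
    rw [← mul_pow, ← sq_abs (inner ℝ z v.space)]
    exact pow_le_pow_left₀ (abs_nonneg _) h2 2
  rw [← h] at h1
  have h3 := v.time_sq
  nlinarith

theorem lorentz_sub (u v : HyperbolicSpace n) :
    ‖u.space - form u v • v.space‖ ^ 2 - (u.time - form u v * v.time) ^ 2 = form u v ^ 2 - 1 := by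
  have hu := u.time_sq
  have hv := v.time_sq
  rw [norm_sub_sq_real, norm_smul, mul_pow, Real.norm_eq_abs, sq_abs, real_inner_smul_right]
  have hf : inner ℝ u.space v.space = u.time * v.time - form u v := by unfold form; ring
  rw [hf]
  nlinarith

theorem orthogonal_sub (u v : HyperbolicSpace n) :
    (u.time - form u v * v.time) * v.time = inner ℝ (u.space - form u v • v.space) v.space := by
  have hv := v.time_sq
  rw [inner_sub_left, real_inner_smul_left, real_inner_self_eq_norm_sq]
  have hf : inner ℝ u.space v.space = u.time * v.time - form u v := by unfold form; ring
  rw [hf]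
  linear_combination (-(form u v)) * hv

theorem form_pos (u v : HyperbolicSpace n) : 0 < form u v := by
  have h1 := real_inner_le_norm u.space v.space
  have hu : ‖u.space‖ < u.time := by
    apply lt_of_pow_lt_pow_left₀ 2 u.time_pos.le
    linarith [u.time_sq]
  have hv : ‖v.space‖ < v.time := by
    apply lt_of_pow_lt_pow_left₀ 2 v.time_pos.le
    linarith [v.time_sq]
  have h2 := mul_lt_mul'' hu hv (norm_nonneg _) (norm_nonneg _)
  unfold form
  linarith

theorem one_le_form (u v : HyperbolicSpace n) : 1 ≤ form u v := by
  have h := norm_sq_le_of_orthogonal v _ _ (orthogonal_sub u v)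
  rw [lorentz_sub] at h
  have h1 : 0 ≤ form u v ^ 2 - 1 := by
    by_contra hc
    have := mul_neg_of_neg_of_pos (not_le.mp hc) (pow_pos v.time_pos 2)
    linarith [sq_nonneg ‖u.space - form u v • v.space‖]
  nlinarith [form_pos u v]

theorem eq_of_form_eq_one {u v : HyperbolicSpace n} (h : form u v = 1) : u = v := by
  have h1 := norm_sq_le_of_orthogonal v _ _ (orthogonal_sub u v)
  rw [lorentz_sub, h] at h1
  have h2 : u.space - (1 : ℝ) • v.space = 0 := by
    rw [← norm_eq_zero]
    have := norm_nonneg (u.space - (1 : ℝ) • v.space)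
    nlinarith
  have h3 := lorentz_sub u v
  rw [h, h2] at h3
  have h4 : u.time - 1 * v.time = 0 := by
    apply pow_eq_zero_iff (two_ne_zero) |>.mp
    simpa using h3
  ext1
  · linarith
  · rw [one_smul] at h2
    exact sub_eq_zero.mp h2

theorem form_le (x y z : HyperbolicSpace n) :
    form x z ≤ form x y * form y z + √(form x y ^ 2 - 1) * √(form y z ^ 2 - 1) := by
  rw [form_comm y z]
  have key : ∀ t : ℝ, 0 ≤ (form z y ^ 2 - 1) * (t * t)
      + (2 * (form x y * form z y - form x z)) * t + (form x y ^ 2 - 1) := by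
    intro t
    have ho : ((x.time - form x y * y.time) + t * (z.time - form z y * y.time)) * y.time
        = inner ℝ ((x.space - form x y • y.space) + t • (z.space - form z y • y.space)) y.space := by
      rw [inner_add_left, real_inner_smul_left, ← orthogonal_sub, ← orthogonal_sub]
      ring
    have h1 := norm_sq_le_of_orthogonal y _ _ ho
    have h2 : 0 ≤ ‖(x.space - form x y • y.space) + t • (z.space - form z y • y.space)‖ ^ 2
        - ((x.time - form x y * y.time) + t * (z.time - form z y * y.time)) ^ 2 := by
      by_contra hc
      have := mul_neg_of_neg_of_pos (not_le.mp hc) (pow_pos y.time_pos 2)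
      linarith [sq_nonneg ‖(x.space - form x y • y.space) + t • (z.space - form z y • y.space)‖]
    have hy := y.time_sq
    have e1 : inner ℝ x.space y.space = x.time * y.time - form x y := by unfold form; ring
    have e2 : inner ℝ y.space z.space = z.time * y.time - form z y := by
      rw [real_inner_comm]; unfold form; ring
    have e3 : inner ℝ x.space z.space = x.time * z.time - form x z := by unfold form; ring
    rw [norm_add_sq_real, norm_smul, mul_pow, Real.norm_eq_abs, sq_abs, real_inner_smul_right,
      inner_sub_left, inner_sub_right, inner_sub_right, real_inner_smul_left, real_inner_smul_left,
      real_inner_smul_right, real_inner_smul_right, real_inner_self_eq_norm_sq, e1, e2, e3] at h2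
    have l1 := lorentz_sub x y
    have l2 := lorentz_sub z y
    refine h2.trans_eq ?_
    linear_combination l1 + t ^ 2 * l2 - 2 * t * (form x y * form z y) * hy
  have hd := discrim_le_zero key
  unfold discrim at hd
  have ha : 0 ≤ form x y ^ 2 - 1 := by nlinarith [one_le_form x y]
  rw [← Real.sqrt_mul ha]
  have : |form x z - form x y * form z y| ≤ √((form x y ^ 2 - 1) * (form z y ^ 2 - 1)) := by
    apply Real.abs_le_sqrt
    nlinarith
  linarith [le_abs_self (form x z - form x y * form z y)]

/-- The hyperbolic distance: `cosh d(x, y)` is minus the Lorentz product of `x` and `y`. -/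
noncomputable instance : MetricSpace (HyperbolicSpace n) where
  dist x y := Real.arcosh (form x y)
  dist_self x := by
    rw [form_self]
    exact (Real.arcosh_eq_zero_iff le_rfl).mpr rfl
  dist_comm x y := by
    rw [form_comm]
  dist_triangle x y z := by
    have h1 := one_le_form x y
    have h2 := one_le_form y z
    have h3 := one_le_form x z
    have h0 : 0 ≤ Real.arcosh (form x y) + Real.arcosh (form y z) :=
      add_nonneg (Real.arcosh_nonneg h1) (Real.arcosh_nonneg h2)
    rw [← Real.arcosh_cosh h0,
      Real.arcosh_le_arcosh (by linarith) (Real.cosh_pos _), Real.cosh_add,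
      Real.cosh_arcosh h1, Real.cosh_arcosh h2, Real.sinh_arcosh h1, Real.sinh_arcosh h2]
    exact form_le x y z
  eq_of_dist_eq_zero {x y} h :=
    eq_of_form_eq_one ((Real.arcosh_eq_zero_iff (one_le_form x y)).mp h)

theorem dist_eq (x y : HyperbolicSpace n) :
    dist x y = Real.arcosh (x.time * y.time - inner ℝ x.space y.space) := rfl

end HyperbolicSpace

/-! ### Geodesic segments and quasi-isometries -/

/-- The points between `x` and `y`, i.e. the union of the geodesics from `x` to `y` when the ambient
space is geodesic. In `ℍⁿ` and in metric trees this is the unique geodesic segment `[xy]`. -/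
def geodesicSegment {α : Type*} [MetricSpace α] (x y : α) : Set α :=
  {z | dist x z + dist z y = dist x y}

/-- `f` is an `(L, A)`-quasi-isometry from `α` to `β`: `f` and some map `g : β → α` distort distances
at most by the factor `L` and the additive error `A`, and are inverse to each other up to `A`. -/
def IsQuasiIsometry {α β : Type*} [MetricSpace α] [MetricSpace β] (L A : ℝ) (f : α → β) : Prop :=
  (∀ x₁ x₂ : α, -A + 1 / L * dist x₁ x₂ ≤ dist (f x₁) (f x₂) ∧
    dist (f x₁) (f x₂) ≤ L * dist x₁ x₂ + A) ∧
  ∃ g : β → α,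
    (∀ y₁ y₂ : β, -A + 1 / L * dist y₁ y₂ ≤ dist (g y₁) (g y₂) ∧
      dist (g y₁) (g y₂) ≤ L * dist y₁ y₂ + A) ∧
    (∀ x : α, dist x (g (f x)) ≤ A) ∧
    (∀ y : β, dist y (f (g y)) ≤ A)

/-! ### Finite metric trees -/

/-- A structure of finite metric tree on a metric space `T`: `T` is a real tree (a geodesic space which
satisfies the four-point inequality with constant `0`) that is spanned by a finite set of vertices which
contains all branch points. Vertices of valence two are allowed. -/
structure FiniteMetricTree (T : Type*) [MetricSpace T] where
  geodesic : ∀ x y : T, ∃ γ : ℝ → T, γ 0 = x ∧ γ (dist x y) = y ∧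
    ∀ s ∈ Set.Icc 0 (dist x y), ∀ t ∈ Set.Icc 0 (dist x y), dist (γ s) (γ t) = |s - t|
  four_point : ∀ x y z w : T,
    dist x y + dist z w ≤ max (dist x z + dist y w) (dist x w + dist y z)
  vertices : Finset T
  spanned : ∀ x : T, ∃ v ∈ vertices, ∃ w ∈ vertices, x ∈ geodesicSegment v w
  branch : ∀ u ∈ vertices, ∀ v ∈ vertices, ∀ w ∈ vertices, ∀ o : T,
    o ∈ geodesicSegment u v → o ∈ geodesicSegment v w → o ∈ geodesicSegment w u → o ∈ vertices

/-- Two distinct vertices are joined by an edge if no other vertex lies between them. -/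
def FiniteMetricTree.Adj {T : Type*} [MetricSpace T] (S : FiniteMetricTree T) (v w : T) : Prop :=
  v ∈ S.vertices ∧ w ∈ S.vertices ∧ v ≠ w ∧
    ∀ u ∈ S.vertices, u ∈ geodesicSegment v w → u = v ∨ u = w

/-- The leaves: the vertices of valence one. -/
def FiniteMetricTree.leaves {T : Type*} [MetricSpace T] (S : FiniteMetricTree T) : Set T :=
  {v | v ∈ S.vertices ∧ {w | S.Adj v w}.ncard = 1}

/-! ### Comparison tripods -/

section Tripod

variable {α : Type*} [MetricSpace α]

/-- The triangle with the given vertices (the union of its three sides), possibly degenerate. -/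
def triangle (x : Fin 3 → α) : Set α :=
  ⋃ (i : Fin 3) (j : Fin 3), geodesicSegment (x i) (x j)

/-- The length of the `i`-th leg of the comparison tripod. -/
noncomputable def tripodLeg (x : Fin 3 → α) (i : Fin 3) : ℝ :=
  (dist (x i) (x (i + 1)) + dist (x i) (x (i + 2)) - dist (x (i + 1)) (x (i + 2))) / 2

/-- The vertices are not collinear: every triangle inequality between them is strict. -/
def IsNondegenerate (x : Fin 3 → α) : Prop :=
  ∀ i, 0 < tripodLeg x i

/-- The `i`-th end point of the comparison tripod. -/
noncomputable def tripodEnd (x : Fin 3 → α) (i : Fin 3) : PiLp 1 (fun _ : Fin 3 => ℝ) :=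
  PiLp.single 1 i (tripodLeg x i)

/-- The comparison tripod of a triangle: three legs of the prescribed lengths on the three coordinate
half-axes, glued at `0`; the `ℓ¹`-distance restricts to the path metric. -/
def comparisonTripod (x : Fin 3 → α) : Set (PiLp 1 (fun _ : Fin 3 => ℝ)) :=
  {a | ∃ (i : Fin 3) (t : ℝ), 0 ≤ t ∧ t ≤ tripodLeg x i ∧ a = PiLp.single 1 i t}

theorem tripodLeg_nonneg (x : Fin 3 → α) (i : Fin 3) : 0 ≤ tripodLeg x i := by
  have := dist_triangle_left (x (i + 1)) (x (i + 2)) (x i)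
  unfold tripodLeg
  linarith

theorem dist_tripodEnd (x : Fin 3 → α) (i j : Fin 3) :
    dist (tripodEnd x i) (tripodEnd x j) = dist (x i) (x j) := by
  have h0 := tripodLeg_nonneg x 0
  have h1 := tripodLeg_nonneg x 1
  have h2 := tripodLeg_nonneg x 2
  have e0 : tripodLeg x 0 = (dist (x 0) (x 1) + dist (x 0) (x 2) - dist (x 1) (x 2)) / 2 := rfl
  have e1 : tripodLeg x 1 = (dist (x 1) (x 2) + dist (x 1) (x 0) - dist (x 2) (x 0)) / 2 := rfl
  have e2 : tripodLeg x 2 = (dist (x 2) (x 0) + dist (x 2) (x 1) - dist (x 0) (x 1)) / 2 := rfl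
  have c1 := dist_comm (x 1) (x 0)
  have c2 := dist_comm (x 2) (x 0)
  have c3 := dist_comm (x 2) (x 1)
  rw [PiLp.dist_eq_of_L1]
  fin_cases i <;> fin_cases j <;>
    simp [Fin.sum_univ_three, tripodEnd, Real.dist_eq, abs_of_nonneg, h0, h1, h2] <;> linarith

/-- `χ` is the comparison map from the triangle to its comparison tripod: it sends vertices to end
points and is isometric on each side. -/
structure IsComparisonMap (x : Fin 3 → α) (χ : α → PiLp 1 (fun _ : Fin 3 => ℝ)) : Prop where
  mapsTo : Set.MapsTo χ (triangle x) (comparisonTripod x)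
  map_vertex : ∀ i, χ (x i) = tripodEnd x i
  isometry : ∀ i j, ∀ z ∈ geodesicSegment (x i) (x j), ∀ w ∈ geodesicSegment (x i) (x j),
    dist (χ z) (χ w) = dist z w

/-- `z` is the internal point of the side `[xᵢxⱼ]`: it is sent to the branch point of the tripod. -/
def IsInternalPoint (x : Fin 3 → α) (χ : α → PiLp 1 (fun _ : Fin 3 => ℝ)) (i j : Fin 3) (z : α) :
    Prop :=
  z ∈ geodesicSegment (x i) (x j) ∧ χ z = 0

/-- `φ` restricts on the triangle with vertices `xᵢ` to the extension of `xᵢ ↦ yᵢ` which sends the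
internal points to the branch point `o` of the tripod `[y₀y₁y₂]` of a tree and which maps the segment
from `xᵢ` to the internal point of each adjacent side onto `[yᵢo]` as a dilation. -/
def IsTriangleMap {T : Type*} [MetricSpace T] (x : Fin 3 → α) (y : Fin 3 → T) (φ : α → T) : Prop :=
  ∃ (χ : α → PiLp 1 (fun _ : Fin 3 => ℝ)) (o : T),
    IsComparisonMap x χ ∧
    (∀ i j, i ≠ j → o ∈ geodesicSegment (y i) (y j)) ∧
    (∀ i, φ (x i) = y i) ∧
    ∀ i j, i ≠ j → ∀ z, IsInternalPoint x χ i j z →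
      φ z = o ∧
      ∀ w ∈ geodesicSegment (x i) z,
        φ w ∈ geodesicSegment (y i) o ∧
        dist (y i) (φ w) = dist (y i) o / dist (x i) z * dist (x i) w

end Tripod

/-! ### Quasi-convex hulls and Gromov approximating trees -/

/-- The quasi-convex hull `Q(X)`: the union of the geodesic segments between points of `X`. -/
def quasiConvexHull {n : ℕ} (X : Finset (HyperbolicSpace n)) : Set (HyperbolicSpace n) :=
  ⋃ (x ∈ X) (y ∈ X), geodesicSegment x y

theorem mem_quasiConvexHull {n : ℕ} {X : Finset (HyperbolicSpace n)} (x : X) :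
    (x : HyperbolicSpace n) ∈ quasiConvexHull X := by
  simp only [quasiConvexHull, Set.mem_iUnion]
  exact ⟨x, x.2, x, x.2, by simp [geodesicSegment]⟩

/-- `(T, p)` is a Gromov approximating tree for `X`, with constant `c` (to be used for
`|X| ≤ 2 ^ c + 2`): `p` maps `X` to vertices, every leaf lies in `p(X)`, and `p` does not increase
distances and decreases them by at most `2 c log 3`. -/
structure IsGromovApproximatingTree {n : ℕ} (c : ℝ) (X : Finset (HyperbolicSpace n))
    {T : Type*} [MetricSpace T] (S : FiniteMetricTree T) (p : X → T) : Prop where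
  map_vertices : ∀ x, p x ∈ S.vertices
  leaves_subset : S.leaves ⊆ Set.range p
  le_dist : ∀ x₁ x₂ : X, dist x₁ x₂ - 2 * c * Real.log 3 ≤ dist (p x₁) (p x₂)
  dist_le : ∀ x₁ x₂ : X, dist (p x₁) (p x₂) ≤ dist x₁ x₂

/-!
Hyperbolic space is strongly hyperbolic: `exp (dist / 2)` satisfies Ptolemy's inequality
(`HyperbolicSpace.exp_ptolemy`). Over each point `x` of `ℍⁿ` there are two null vectors `(time, space, ±1)`, which
are two points of a round sphere. The chords between such points over `x` and `y` are, up to a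
common normalization, `2 sinh (dist x y / 2)` and `2 cosh (dist x y / 2)`, and summing the Euclidean
Ptolemy inequality over all signs gives the claim. It has two consequences. The four-point inequality
holds with the additive error `2 log 2`. And `exp (-(x|y))`, with a Gromov product in the exponent,
satisfies the triangle inequality, so that a chain of `m` Gromov products which are at least `t` from
`x` to `y` forces `(x|y) ≥ t - log m`.

For the first part, the largest `t` for which such a chain in `X` exists is an ultrametric Gromov
product (`chainProduct`), and such a product is realized by a finite metric tree, made of one branch
`[0, dist w x]` for each `x` in `X` (`TreeProduct.finiteMetricTree`). A chain need not repeat a point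
nor meet the base point, and so it has at most `|X| - 2 ≤ 2 ^ c` links; this is the bound on the
distortion of the tree.

For the second part, let `a` be an end point of the edge `e`, and subdivide the segments from `a` to
the points of `X` at the points of `X` on them. Since geodesics do not branch, the edges between
consecutive points `u`, `y` meet only at points of `X`. On each of them the hull map is taken to be
the triangle map of a triangle with side `[uy]`; these maps fit together, continuously along `e`.
A finite tree is covered by the segments from a given vertex to its leaves, which lie in `p(X)`, and
so the map is onto. Elsewhere on the hull any triangle map is taken. The triangle can be chosen
nondegenerate when there is a nondegenerate triangle at all, because the points collinear with
`u` and `y` are mutually collinear (a Gram determinant vanishes).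

Finally, a triangle map moves the distances from a point of a side to the ends of that side by at
most twice the distortion `κ = 2 c log 3` of `p`. As the distance of two points on segments is
determined by the distances to the end points, exactly in a tree and up to `4 log 2` in `ℍⁿ`, the
hull map distorts distances by at most `5 κ + 4 log 2`. Being onto, it is a quasi-isometry whose
quasi-inverse is any right inverse.
-/

/-! ### Strong hyperbolicity of real hyperbolic space -/

namespace HyperbolicSpace

variable {n : ℕ}

theorem cosh_dist (x y : HyperbolicSpace n) : Real.cosh (dist x y) = form x y :=
  Real.cosh_arcosh (one_le_form x y)

/-- The two points at infinity, for `σ = ±1`, of the geodesic of `ℍⁿ⁺¹` which is perpendicular to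
`ℍⁿ` at `x`, seen on the unit sphere: the null vector `(time, space, σ)` divided by its time. -/
noncomputable def nullPoint (σ : ℝ) (x : HyperbolicSpace n) :
    WithLp 2 (EuclideanSpace ℝ (Fin n) × ℝ) :=
  WithLp.toLp 2 (x.time⁻¹ • x.space, σ / x.time)

/-- The chordal distance between the points `nullPoint σ x` and `nullPoint τ y`, in the
normalization which makes it independent of the choice of a time coordinate. -/
noncomputable def chord (σ τ : ℝ) (x y : HyperbolicSpace n) : ℝ :=
  dist (nullPoint σ x) (nullPoint τ y) * (√x.time * √y.time)

theorem chord_nonneg (σ τ : ℝ) (x y : HyperbolicSpace n) : 0 ≤ chord σ τ x y := by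
  unfold chord; positivity

theorem chord_sq {σ τ : ℝ} (hσ : σ ^ 2 = 1) (hτ : τ ^ 2 = 1) (x y : HyperbolicSpace n) :
    chord σ τ x y ^ 2 = 2 * (form x y - σ * τ) := by
  have hx := x.time_pos
  have hy := y.time_pos
  unfold chord
  rw [mul_pow, mul_pow, Real.sq_sqrt hx.le, Real.sq_sqrt hy.le, dist_eq_norm,
    WithLp.prod_norm_sq_eq_of_L2]
  change (‖x.time⁻¹ • x.space - y.time⁻¹ • y.space‖ ^ 2 + ‖σ / x.time - τ / y.time‖ ^ 2) * _ = _
  rw [norm_sub_sq_real, norm_smul, norm_smul, inner_smul_left, inner_smul_right, mul_pow, mul_pow]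
  simp only [Real.norm_eq_abs, sq_abs, conj_trivial]
  have h1 : ‖x.space‖ ^ 2 = x.time ^ 2 - 1 := by linarith [x.time_sq]
  have h2 : ‖y.space‖ ^ 2 = y.time ^ 2 - 1 := by linarith [y.time_sq]
  have h3 : inner ℝ x.space y.space = x.time * y.time - form x y := by unfold form; ring
  rw [h1, h2, h3]
  field_simp
  linear_combination (y.time ^ 2) * hσ + x.time ^ 2 * hτ

theorem chord_ptolemy (σ τ υ ω : ℝ) (x y z o : HyperbolicSpace n) :
    chord σ τ x y * chord υ ω z o ≤
      chord σ υ x z * chord τ ω y o + chord τ υ y z * chord σ ω x o := by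
  have h := EuclideanGeometry.mul_dist_le_mul_dist_add_mul_dist
    (nullPoint σ x) (nullPoint υ z) (nullPoint τ y) (nullPoint ω o)
  have hp : 0 ≤ √x.time * √y.time * √z.time * √o.time := by positivity
  have h' := mul_le_mul_of_nonneg_right h hp
  unfold chord
  rw [dist_comm (nullPoint υ z) (nullPoint τ y)] at h'
  linarith

theorem chord_eq_sinh {σ τ : ℝ} (hσ : σ ^ 2 = 1) (hτ : τ ^ 2 = 1) (h : σ * τ = 1)
    (x y : HyperbolicSpace n) : chord σ τ x y = 2 * Real.sinh (dist x y / 2) := by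
  refine (sq_eq_sq₀ (chord_nonneg _ _ _ _) ?_).mp ?_
  · have : 0 ≤ dist x y / 2 := by positivity
    have := Real.sinh_nonneg_iff.mpr this
    positivity
  · rw [chord_sq hσ hτ, h, ← cosh_dist, ← mul_div_cancel₀ (dist x y) (two_ne_zero' ℝ),
      Real.cosh_two_mul, Real.cosh_sq]
    ring_nf

theorem chord_eq_cosh {σ τ : ℝ} (hσ : σ ^ 2 = 1) (hτ : τ ^ 2 = 1) (h : σ * τ = -1)
    (x y : HyperbolicSpace n) : chord σ τ x y = 2 * Real.cosh (dist x y / 2) := by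
  refine (sq_eq_sq₀ (chord_nonneg _ _ _ _) ?_).mp ?_
  · have := Real.cosh_pos (dist x y / 2)
    positivity
  · have h2 : dist x y = 2 * (dist x y / 2) := by ring
    have h3 := Real.cosh_two_mul (dist x y / 2)
    have h4 := Real.cosh_sq (dist x y / 2)
    rw [← h2, cosh_dist] at h3
    rw [chord_sq hσ hτ, h]
    linear_combination 2 * h3 - 2 * h4

/-- Hyperbolic space is strongly hyperbolic: `exp (dist / 2)` satisfies Ptolemy's inequality. Up to
a factor, `exp (dist x y / 2)` is the sum of the chords between the points `nullPoint (±1)` over `x`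
and those over `y`, so the claim is the sum of Ptolemy's inequalities over all choices of signs. -/
theorem exp_ptolemy (x y z o : HyperbolicSpace n) :
    Real.exp ((dist x y + dist z o) / 2) ≤
      Real.exp ((dist x z + dist y o) / 2) + Real.exp ((dist y z + dist x o) / 2) := by
  have e : ∀ a b c d : HyperbolicSpace n, Real.exp ((dist a b + dist c d) / 2) =
      (Real.cosh (dist a b / 2) + Real.sinh (dist a b / 2)) *
      (Real.cosh (dist c d / 2) + Real.sinh (dist c d / 2)) := by
    intro a b c d
    rw [Real.cosh_add_sinh, Real.cosh_add_sinh, ← Real.exp_add]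
    ring_nf
  have s1 := fun a b : HyperbolicSpace n =>
    chord_eq_sinh (σ := 1) (τ := 1) (by norm_num) (by norm_num) (by norm_num) a b
  have c1 := fun a b : HyperbolicSpace n =>
    chord_eq_cosh (σ := 1) (τ := -1) (by norm_num) (by norm_num) (by norm_num) a b
  have c2 := fun a b : HyperbolicSpace n =>
    chord_eq_cosh (σ := -1) (τ := 1) (by norm_num) (by norm_num) (by norm_num) a b
  have s2 := fun a b : HyperbolicSpace n =>
    chord_eq_sinh (σ := -1) (τ := -1) (by norm_num) (by norm_num) (by norm_num) a b
  have p1 := chord_ptolemy 1 1 1 1 x y z o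
  have p2 := chord_ptolemy 1 1 (-1) (-1) x y z o
  have p3 := chord_ptolemy 1 (-1) 1 (-1) x y z o
  have p4 := chord_ptolemy 1 (-1) (-1) 1 x y z o
  have p5 := chord_ptolemy 1 1 1 (-1) x y z o
  have p6 := chord_ptolemy 1 1 (-1) 1 x y z o
  have p7 := chord_ptolemy 1 (-1) 1 1 x y z o
  have p8 := chord_ptolemy (-1) 1 1 1 x y z o
  simp only [s1, c1, c2, s2] at p1 p2 p3 p4 p5 p6 p7 p8
  rw [e, e, e]
  linarith

theorem four_point (x y z o : HyperbolicSpace n) :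
    dist x y + dist z o ≤
      max (dist x z + dist y o) (dist y z + dist x o) + 2 * Real.log 2 := by
  have h := exp_ptolemy x y z o
  set M := max (dist x z + dist y o) (dist y z + dist x o) with hM
  have h1 : Real.exp ((dist x z + dist y o) / 2) ≤ Real.exp (M / 2) :=
    Real.exp_le_exp.mpr (by linarith [le_max_left (dist x z + dist y o) (dist y z + dist x o)])
  have h2 : Real.exp ((dist y z + dist x o) / 2) ≤ Real.exp (M / 2) :=
    Real.exp_le_exp.mpr (by linarith [le_max_right (dist x z + dist y o) (dist y z + dist x o)])
  have h3 : Real.exp ((dist x y + dist z o) / 2) ≤ Real.exp (M / 2 + Real.log 2) := by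
    rw [Real.exp_add, Real.exp_log two_pos]
    linarith
  have := Real.exp_le_exp.mp h3
  linarith

/-! ### Geodesic segments of real hyperbolic space -/

/-- A point of a segment as a linear combination of the end points in Minkowski space. Indeed the
difference of the two sides is orthogonal to `z` and has Lorentz norm zero. -/
theorem sinh_smul_of_mem_geodesicSegment {x y z : HyperbolicSpace n}
    (h : z ∈ geodesicSegment x y) :
    Real.sinh (dist x y) * z.time =
        Real.sinh (dist z y) * x.time + Real.sinh (dist x z) * y.time ∧
      Real.sinh (dist x y) • z.space =
        Real.sinh (dist z y) • x.space + Real.sinh (dist x z) • y.space := by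
  have hd : dist x z + dist z y = dist x y := h
  have cxz := cosh_dist x z
  have czy := cosh_dist z y
  have cxy := cosh_dist x y
  rw [← hd] at cxy ⊢
  set a := dist x z
  set b := dist z y
  have ix : inner ℝ x.space z.space = x.time * z.time - Real.cosh a := by
    rw [cxz]; unfold form; ring
  have iy : inner ℝ y.space z.space = y.time * z.time - Real.cosh b := by
    rw [czy, form_comm]; unfold form; ring
  have ixy : inner ℝ x.space y.space = x.time * y.time - Real.cosh (a + b) := by
    rw [cxy]; unfold form; ring
  have hx := x.time_sq
  have hy := y.time_sq
  have hz := z.time_sq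
  have ho : (Real.sinh b * x.time + Real.sinh a * y.time - Real.sinh (a + b) * z.time) * z.time =
      inner ℝ (Real.sinh b • x.space + Real.sinh a • y.space - Real.sinh (a + b) • z.space)
        z.space := by
    rw [inner_sub_left, inner_add_left, real_inner_smul_left, real_inner_smul_left,
      real_inner_smul_left, ix, iy, real_inner_self_eq_norm_sq, Real.sinh_add]
    linear_combination -(Real.sinh a * Real.cosh b + Real.cosh a * Real.sinh b) * hz
  have hq : ‖Real.sinh b • x.space + Real.sinh a • y.space - Real.sinh (a + b) • z.space‖ ^ 2 =
      (Real.sinh b * x.time + Real.sinh a * y.time - Real.sinh (a + b) * z.time) ^ 2 := by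
    rw [norm_sub_sq_real, norm_add_sq_real, inner_add_left]
    simp only [norm_smul, mul_pow, Real.norm_eq_abs, sq_abs, real_inner_smul_left,
      real_inner_smul_right]
    rw [ix, iy, ixy, Real.sinh_add, Real.cosh_add]
    have ha := Real.cosh_sq a
    have hb := Real.cosh_sq b
    have e1 : ‖x.space‖ ^ 2 = x.time ^ 2 - 1 := by linarith
    have e2 : ‖y.space‖ ^ 2 = y.time ^ 2 - 1 := by linarith
    have e3 : ‖z.space‖ ^ 2 = z.time ^ 2 - 1 := by linarith
    rw [e1, e2, e3]
    linear_combination (Real.sinh b ^ 2) * ha + (Real.sinh a ^ 2) * hb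
  have h1 := norm_sq_le_of_orthogonal z _ _ ho
  rw [hq, sub_self, zero_mul] at h1
  have h2 : Real.sinh b * x.time + Real.sinh a * y.time - Real.sinh (a + b) * z.time = 0 := by
    nlinarith
  rw [h2] at hq
  have h3 : Real.sinh b • x.space + Real.sinh a • y.space - Real.sinh (a + b) • z.space = 0 := by
    rw [← norm_eq_zero]
    simpa using hq
  exact ⟨by linarith, (sub_eq_zero.mp h3).symm⟩

theorem form_of_mem_geodesicSegment {x y z : HyperbolicSpace n} (h : z ∈ geodesicSegment x y)
    (w : HyperbolicSpace n) : Real.sinh (dist x y) * form z w =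
      Real.sinh (dist z y) * form x w + Real.sinh (dist x z) * form y w := by
  obtain ⟨h1, h2⟩ := sinh_smul_of_mem_geodesicSegment h
  have h3 := congrArg (fun v => inner ℝ v w.space) h2
  simp only [inner_add_left, real_inner_smul_left] at h3
  unfold form
  linear_combination w.time * h1 - h3

theorem dist_eq_abs_sub_of_mem_geodesicSegment {x y z w : HyperbolicSpace n}
    (hz : z ∈ geodesicSegment x y) (hw : w ∈ geodesicSegment x y) :
    dist z w = |dist x z - dist x w| := by
  have h1 : dist x z + dist z y = dist x y := hz
  have h2 : dist x w + dist w y = dist x y := hw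
  rcases (dist_nonneg (x := x) (y := y)).eq_or_lt with h0 | h0
  · have := dist_nonneg (x := x) (y := z)
    have := dist_nonneg (x := z) (y := y)
    have := dist_nonneg (x := x) (y := w)
    have := dist_nonneg (x := w) (y := y)
    have e1 : dist x z = 0 := by linarith
    have e2 : dist x w = 0 := by linarith
    rw [← dist_eq_zero.mp e1, ← dist_eq_zero.mp e2]
    simp
  · have hs : Real.sinh (dist x y) ≠ 0 := (Real.sinh_pos_iff.mpr h0).ne'
    have h := form_of_mem_geodesicSegment hz w
    rw [← cosh_dist, ← cosh_dist, ← cosh_dist, dist_comm y w] at h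
    have e1 : dist z y = dist x y - dist x z := by linarith
    have e2 : dist w y = dist x y - dist x w := by linarith
    have e3 : Real.cosh (dist z w) = Real.cosh (dist x z - dist x w) := by
      apply mul_left_cancel₀ hs
      rw [h, e1, e2, Real.sinh_sub, Real.cosh_sub, Real.cosh_sub]
      ring
    rw [← Real.arcosh_cosh (dist_nonneg (x := z) (y := w)), e3, ← Real.cosh_abs,
      Real.arcosh_cosh (abs_nonneg _)]

theorem exists_dist_eq_of_le_dist (x y : HyperbolicSpace n) {r : ℝ} (h0 : 0 ≤ r)
    (hr : r ≤ dist x y) : ∃ z ∈ geodesicSegment x y, dist x z = r := by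
  rcases (dist_nonneg (x := x) (y := y)).eq_or_lt with hd | hd
  · exact ⟨x, by simp [geodesicSegment], by rw [dist_self]; linarith⟩
  have hs : 0 < Real.sinh (dist x y) := Real.sinh_pos_iff.mpr hd
  have hsr : 0 ≤ Real.sinh r := Real.sinh_nonneg_iff.mpr h0
  have hsr' : 0 ≤ Real.sinh (dist x y - r) := Real.sinh_nonneg_iff.mpr (by linarith)
  have cxy := cosh_dist x y
  set D := dist x y
  have hx := x.time_sq
  have hy := y.time_sq
  have i1 : inner ℝ x.space y.space = x.time * y.time - Real.cosh D := by
    rw [cxy]; unfold form; ring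
  have hD := Real.cosh_sq D
  have hR := Real.cosh_sq r
  have hpos : 0 < Real.sinh (D - r) * x.time + Real.sinh r * y.time := by
    rcases h0.eq_or_lt with h | h
    · have : 0 < Real.sinh (D - r) := Real.sinh_pos_iff.mpr (by linarith)
      have := mul_pos this x.time_pos
      have := mul_nonneg hsr y.time_pos.le
      linarith
    · have : 0 < Real.sinh r := Real.sinh_pos_iff.mpr h
      have := mul_pos this y.time_pos
      have := mul_nonneg hsr' x.time_pos.le
      linarith
  let z : HyperbolicSpace n :=
    { time := (Real.sinh D)⁻¹ * (Real.sinh (D - r) * x.time + Real.sinh r * y.time)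
      space := (Real.sinh D)⁻¹ • (Real.sinh (D - r) • x.space + Real.sinh r • y.space)
      time_pos := mul_pos (inv_pos.mpr hs) hpos
      time_sq := by
        rw [norm_smul, mul_pow, mul_pow, norm_add_sq_real, Real.norm_eq_abs, sq_abs]
        simp only [norm_smul, mul_pow, Real.norm_eq_abs, sq_abs, real_inner_smul_left,
          real_inner_smul_right]
        rw [i1, Real.sinh_sub]
        have e1 : ‖x.space‖ ^ 2 = x.time ^ 2 - 1 := by linarith
        have e2 : ‖y.space‖ ^ 2 = y.time ^ 2 - 1 := by linarith
        rw [e1, e2]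
        field_simp
        linear_combination (Real.sinh D ^ 2) * hR - Real.sinh r ^ 2 * hD }
  have f1 : form x z = Real.cosh r := by
    have : form x z = (Real.sinh D)⁻¹ * (Real.sinh (D - r) + Real.sinh r * Real.cosh D) := by
      simp only [form, z, real_inner_smul_right, inner_add_right, real_inner_self_eq_norm_sq, i1]
      linear_combination (Real.sinh D)⁻¹ * Real.sinh (D - r) * hx
    rw [this, Real.sinh_sub]
    field_simp
    ring
  have f2 : form z y = Real.cosh (D - r) := by
    have : form z y = (Real.sinh D)⁻¹ * (Real.sinh (D - r) * Real.cosh D + Real.sinh r) := by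
      simp only [form, z, real_inner_smul_left, inner_add_left, real_inner_self_eq_norm_sq, i1]
      linear_combination (Real.sinh D)⁻¹ * Real.sinh r * hy
    rw [this, Real.sinh_sub, Real.cosh_sub]
    field_simp
    linear_combination - Real.sinh r * hD
  have d1 : dist x z = r := by
    change Real.arcosh (form x z) = r
    rw [f1, Real.arcosh_cosh h0]
  have d2 : dist z y = D - r := by
    change Real.arcosh (form z y) = D - r
    rw [f2, Real.arcosh_cosh (by linarith)]
  refine ⟨z, ?_, d1⟩
  change dist x z + dist z y = D
  rw [d1, d2]
  ring

/-! ### Collinearity in real hyperbolic space -/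

/-- The point `w` lies in the plane of Minkowski space that is spanned by `x` and `y`: the linear
relation is expressed by the Lorentz products with the points of the hyperboloid, which span. -/
def InSpan (x y w : HyperbolicSpace n) : Prop :=
  ∃ α β : ℝ, ∀ v : HyperbolicSpace n, form w v = α * form x v + β * form y v

theorem inSpan_left (x y : HyperbolicSpace n) : InSpan x y x := ⟨1, 0, fun v => by ring⟩

theorem InSpan.symm {x y w : HyperbolicSpace n} (h : InSpan x y w) : InSpan y x w := by
  obtain ⟨α, β, h⟩ := h
  exact ⟨β, α, fun v => by rw [h]; ring⟩

theorem inSpan_of_mem_geodesicSegment {x y z : HyperbolicSpace n} (hne : x ≠ y)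
    (h : z ∈ geodesicSegment x y) : InSpan x y z := by
  have hs : Real.sinh (dist x y) ≠ 0 := (Real.sinh_pos_iff.mpr (dist_pos.mpr hne)).ne'
  refine ⟨Real.sinh (dist z y) / Real.sinh (dist x y), Real.sinh (dist x z) / Real.sinh (dist x y),
    fun v => ?_⟩
  have := form_of_mem_geodesicSegment h v
  field_simp
  linarith

theorem inSpan_of_mem_geodesicSegment' {x y z : HyperbolicSpace n} (hne : x ≠ y)
    (h : y ∈ geodesicSegment x z) : InSpan x y z := by
  have hs : Real.sinh (dist x y) ≠ 0 := (Real.sinh_pos_iff.mpr (dist_pos.mpr hne)).ne'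
  refine ⟨-(Real.sinh (dist y z) / Real.sinh (dist x y)),
    Real.sinh (dist x z) / Real.sinh (dist x y), fun v => ?_⟩
  have := form_of_mem_geodesicSegment h v
  field_simp
  linarith

/-- Three points in a plane of Minkowski space have a singular Gram matrix, whose determinant
factors as `-(cosh a - cosh (b + c)) (cosh a - cosh (b - c))` in the mutual distances. -/
theorem mem_geodesicSegment_of_inSpan {x y w₁ w₂ w₃ : HyperbolicSpace n}
    (h₁ : InSpan x y w₁) (h₂ : InSpan x y w₂) (h₃ : InSpan x y w₃) :
    w₁ ∈ geodesicSegment w₂ w₃ ∨ w₂ ∈ geodesicSegment w₁ w₃ ∨ w₃ ∈ geodesicSegment w₁ w₂ := by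
  obtain ⟨α₁, β₁, h₁⟩ := h₁
  obtain ⟨α₂, β₂, h₂⟩ := h₂
  obtain ⟨α₃, β₃, h₃⟩ := h₃
  have key : ∀ α β α' β' : ℝ, ∀ w w' : HyperbolicSpace n,
      (∀ v, form w v = α * form x v + β * form y v) →
      (∀ v, form w' v = α' * form x v + β' * form y v) →
      form w w' = α * α' + β * β' + (α * β' + α' * β) * form x y := by
    intro α β α' β' w w' h h'
    rw [h, form_comm x, form_comm y, h', h', form_self, form_self, form_comm y x]
    ring
  have k11 := key _ _ _ _ _ _ h₁ h₁
  have k22 := key _ _ _ _ _ _ h₂ h₂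
  have k33 := key _ _ _ _ _ _ h₃ h₃
  have k12 := key _ _ _ _ _ _ h₁ h₂
  have k13 := key _ _ _ _ _ _ h₁ h₃
  have k23 := key _ _ _ _ _ _ h₂ h₃
  have gram : form w₁ w₁ * form w₂ w₂ * form w₃ w₃ + 2 * form w₁ w₂ * form w₁ w₃ * form w₂ w₃
      - form w₁ w₁ * form w₂ w₃ ^ 2 - form w₂ w₂ * form w₁ w₃ ^ 2 - form w₃ w₃ * form w₁ w₂ ^ 2
      = 0 := by
    rw [k11, k22, k33, k12, k13, k23]
    ring
  simp only [form_self, ← cosh_dist] at gram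
  have hp := dist_nonneg (x := w₁) (y := w₂)
  have hq := dist_nonneg (x := w₁) (y := w₃)
  have hr := dist_nonneg (x := w₂) (y := w₃)
  have c1 := dist_comm w₂ w₁
  have c3 := dist_comm w₃ w₂
  simp only [geodesicSegment, Set.mem_ofPred_eq]
  rw [c1, c3]
  generalize dist w₁ w₂ = p at *
  generalize dist w₁ w₃ = q at *
  generalize dist w₂ w₃ = r at *
  have hf : (Real.cosh r - Real.cosh (p + q)) * (Real.cosh r - Real.cosh (p - q)) = 0 := by
    rw [Real.cosh_add, Real.cosh_sub]
    have h1 := Real.cosh_sq p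
    have h2 := Real.cosh_sq q
    linear_combination -gram + (Real.sinh q ^ 2) * h1 + (Real.cosh p ^ 2 - 1) * h2
  have inj : ∀ s t : ℝ, Real.cosh s = Real.cosh t → |s| = |t| := by
    intro s t h
    rw [← Real.cosh_abs s, ← Real.cosh_abs t] at h
    rw [← Real.arcosh_cosh (abs_nonneg s), h, Real.arcosh_cosh (abs_nonneg t)]
  rcases mul_eq_zero.mp hf with h | h
  · have := inj _ _ (sub_eq_zero.mp h)
    rw [abs_of_nonneg hr, abs_of_nonneg (by linarith)] at this
    left; linarith
  · have := inj _ _ (sub_eq_zero.mp h)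
    rw [abs_of_nonneg hr] at this
    rcases abs_cases (p - q) with ⟨h', _⟩ | ⟨h', _⟩
    · right; right; linarith
    · right; left; linarith

/-- Geodesics of hyperbolic space do not branch. -/
theorem mem_geodesicSegment_or_mem_geodesicSegment {a y y' z : HyperbolicSpace n} (hne : a ≠ z)
    (h : z ∈ geodesicSegment a y) (h' : z ∈ geodesicSegment a y') :
    y ∈ geodesicSegment a y' ∨ y' ∈ geodesicSegment a y := by
  rcases mem_geodesicSegment_of_inSpan (inSpan_left a z) (inSpan_of_mem_geodesicSegment' hne h)
    (inSpan_of_mem_geodesicSegment' hne h') with h1 | h1 | h1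
  · exfalso
    have e0 : dist y a + dist a y' = dist y y' := h1
    have e1 : dist a z + dist z y = dist a y := h
    have e2 : dist a z + dist z y' = dist a y' := h'
    have := dist_triangle_left y y' z
    have := dist_comm y a
    have := dist_pos.mpr hne
    linarith
  · exact Or.inl h1
  · exact Or.inr h1

end HyperbolicSpace

/-! ### Segments in metric spaces and in trees -/

section Segment

variable {α : Type*} [MetricSpace α]

theorem mem_geodesicSegment_iff {x y z : α} :
    z ∈ geodesicSegment x y ↔ dist x z + dist z y = dist x y := Iff.rfl

theorem left_mem_geodesicSegment (x y : α) : x ∈ geodesicSegment x y := by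
  simp [mem_geodesicSegment_iff]

theorem right_mem_geodesicSegment (x y : α) : y ∈ geodesicSegment x y := by
  simp [mem_geodesicSegment_iff]

theorem geodesicSegment_comm (x y : α) : geodesicSegment x y = geodesicSegment y x := by
  ext z
  simp only [mem_geodesicSegment_iff, dist_comm, add_comm]

theorem eq_of_mem_geodesicSegment_self {x z : α} (h : z ∈ geodesicSegment x x) : z = x := by
  rw [mem_geodesicSegment_iff, dist_self, dist_comm z x] at h
  exact (dist_eq_zero.mp (by linarith)).symm

theorem isClosed_geodesicSegment (x y : α) : IsClosed (geodesicSegment x y) :=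
  isClosed_eq (by fun_prop) continuous_const

theorem mem_geodesicSegment_trans {v u w t : α} (hu : u ∈ geodesicSegment v w)
    (ht : t ∈ geodesicSegment v u) : t ∈ geodesicSegment v w ∧ u ∈ geodesicSegment t w := by
  simp only [mem_geodesicSegment_iff] at *
  have := dist_triangle v t w
  have := dist_triangle t u w
  exact ⟨by linarith, by linarith⟩

theorem geodesicSegment_subset_left {v u w : α} (hu : u ∈ geodesicSegment v w) :
    geodesicSegment v u ⊆ geodesicSegment v w :=
  fun _ ht => (mem_geodesicSegment_trans hu ht).1

theorem geodesicSegment_subset_right {v u w : α} (hu : u ∈ geodesicSegment v w) :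
    geodesicSegment u w ⊆ geodesicSegment v w := by
  rw [geodesicSegment_comm u, geodesicSegment_comm v]
  rw [geodesicSegment_comm] at hu
  exact geodesicSegment_subset_left hu

theorem eq_of_mem_geodesicSegment_of_mem {v u w : α} (hu : u ∈ geodesicSegment v w)
    (hw : w ∈ geodesicSegment v u) : u = w := by
  simp only [mem_geodesicSegment_iff] at *
  have := dist_comm u w
  have := dist_nonneg (x := u) (y := w)
  exact dist_eq_zero.mp (by linarith)

end Segment

namespace FiniteMetricTree

variable {T : Type*} [MetricSpace T]

theorem mem_or_mem (S : FiniteMetricTree T) {A B t : T} (C : T) (ht : t ∈ geodesicSegment A B) :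
    t ∈ geodesicSegment A C ∨ t ∈ geodesicSegment C B := by
  simp only [mem_geodesicSegment_iff] at *
  have h := S.four_point t C A B
  have := dist_triangle A t C
  have := dist_triangle C t B
  have := dist_comm t A
  have := dist_comm t C
  have := dist_comm C A
  rcases le_max_iff.mp h with h | h
  · right; linarith
  · left; linarith

theorem dist_eq_abs_sub (S : FiniteMetricTree T) {A B t s : T} (ht : t ∈ geodesicSegment A B)
    (hs : s ∈ geodesicSegment A B) : dist t s = |dist A t - dist A s| := by
  simp only [mem_geodesicSegment_iff] at *
  refine le_antisymm ?_ ?_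
  · have h := S.four_point t s A B
    rw [dist_comm t A, dist_comm s A] at h
    rcases le_max_iff.mp h with h | h
    · exact le_trans (by linarith) (le_abs_self _)
    · exact le_trans (by linarith) (neg_le_abs _)
  · rw [abs_le]
    have := dist_triangle A s t
    have := dist_triangle A t s
    have := dist_comm s t
    exact ⟨by linarith, by linarith⟩

theorem exists_dist_eq (S : FiniteMetricTree T) (x y : T) {r : ℝ} (h0 : 0 ≤ r)
    (hr : r ≤ dist x y) : ∃ z ∈ geodesicSegment x y, dist x z = r := by
  obtain ⟨γ, g0, g1, hγ⟩ := S.geodesic x y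
  have a1 := hγ 0 ⟨le_rfl, dist_nonneg⟩ r ⟨h0, hr⟩
  have a2 := hγ r ⟨h0, hr⟩ (dist x y) ⟨dist_nonneg, le_rfl⟩
  rw [g0, zero_sub, abs_neg, abs_of_nonneg h0] at a1
  rw [g1, abs_of_nonpos (by linarith)] at a2
  exact ⟨γ r, by rw [mem_geodesicSegment_iff, a1, a2]; ring, a1⟩

theorem exists_median (S : FiniteMetricTree T) (u v w : T) :
    ∃ o, o ∈ geodesicSegment u v ∧ o ∈ geodesicSegment v w ∧ o ∈ geodesicSegment w u := by
  have h1 := dist_triangle u w v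
  have h2 := dist_triangle u v w
  have h3 := dist_triangle v u w
  have c1 := dist_comm u v
  have c2 := dist_comm u w
  have c3 := dist_comm v w
  obtain ⟨o, ho, hr⟩ := S.exists_dist_eq u v (r := (dist u v + dist u w - dist v w) / 2)
    (by linarith) (by linarith)
  refine ⟨o, ho, ?_⟩
  simp only [mem_geodesicSegment_iff] at *
  have h := S.four_point o w u v
  have := dist_comm o u
  have := dist_comm o v
  have := dist_comm o w
  have := dist_triangle v o w
  have := dist_triangle w o u
  rcases le_max_iff.mp h with h | h <;> exact ⟨by linarith, by linarith⟩

theorem exists_adj (S : FiniteMetricTree T) {v w : T} (hv : v ∈ S.vertices) (hw : w ∈ S.vertices)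
    (hne : v ≠ w) : ∃ u, S.Adj v u ∧ u ∈ geodesicSegment v w := by
  classical
  obtain ⟨u, hu, hmin⟩ := Finset.exists_min_image
    (S.vertices.filter fun u => u ≠ v ∧ u ∈ geodesicSegment v w) (fun u => dist v u)
    ⟨w, Finset.mem_filter.mpr ⟨hw, hne.symm, right_mem_geodesicSegment v w⟩⟩
  obtain ⟨huV, huv, hseg⟩ := Finset.mem_filter.mp hu
  refine ⟨u, ⟨hv, huV, huv.symm, fun u' hu' hs => ?_⟩, hseg⟩
  by_cases h : u' = v
  · exact Or.inl h
  · have := hmin u' (Finset.mem_filter.mpr ⟨hu', h, geodesicSegment_subset_left hseg hs⟩)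
    rw [mem_geodesicSegment_iff] at hs
    exact Or.inr (dist_le_zero.mp (by linarith))

theorem mem_or_mem_of_mem (S : FiniteMetricTree T) {v w s t : T} (hs : s ∈ geodesicSegment v w)
    (ht : t ∈ geodesicSegment v w) : s ∈ geodesicSegment v t ∨ t ∈ geodesicSegment v s := by
  have h := S.dist_eq_abs_sub hs ht
  simp only [mem_geodesicSegment_iff]
  rcases abs_cases (dist v s - dist v t) with ⟨h', _⟩ | ⟨h', _⟩
  · right; rw [dist_comm t s]; linarith
  · left; linarith

theorem adj_unique (S : FiniteMetricTree T) {v w s t : T} (hs : S.Adj v s) (ht : S.Adj v t)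
    (hs' : s ∈ geodesicSegment v w) (ht' : t ∈ geodesicSegment v w) : s = t := by
  rcases S.mem_or_mem_of_mem hs' ht' with h | h
  · exact (ht.2.2.2 s hs.2.1 h).resolve_left hs.2.2.1.symm
  · exact ((hs.2.2.2 t ht.2.1 h).resolve_left ht.2.2.1.symm).symm

/-- A vertex strictly between two vertices has a neighbour in the direction of each of them. -/
theorem notMem_leaves_of_mem_geodesicSegment (S : FiniteMetricTree T) {u v w : T}
    (hu : u ∈ S.vertices) (hw : w ∈ S.vertices) (hvu : v ≠ u) (hvw : v ≠ w)
    (h : v ∈ geodesicSegment u w) : v ∉ S.leaves := by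
  rintro ⟨hv, hcard⟩
  obtain ⟨s, hs, hsu⟩ := S.exists_adj hv hu hvu
  obtain ⟨t, ht, htw⟩ := S.exists_adj hv hw hvw
  obtain ⟨q, hq⟩ := Set.ncard_eq_one.mp hcard
  have e1 : s ∈ ({q} : Set T) := hq ▸ hs
  have e2 : t ∈ ({q} : Set T) := hq ▸ ht
  have e : s = t := e1.trans e2.symm
  subst e
  apply hs.2.2.1
  rw [mem_geodesicSegment_iff] at *
  have := dist_triangle u s w
  have := dist_comm u s
  have := dist_comm u v
  exact dist_le_zero.mp (by linarith)

/-- A tree is covered by the segments from a given vertex to its leaves: a vertex `v` beyond `t` at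
maximal distance from `r` is a leaf, as a neighbour of `v` outside the segment `[rv]` would be
farther away. -/
theorem exists_mem_geodesicSegment_of_leaves_subset (S : FiniteMetricTree T) {A : Set T} {r : T}
    (hr : r ∈ S.vertices) (hrA : r ∈ A) (hA : S.leaves ⊆ A) (t : T) :
    ∃ a ∈ A, t ∈ geodesicSegment r a := by
  classical
  obtain ⟨v₀, hv₀, ht₀⟩ : ∃ v ∈ S.vertices, t ∈ geodesicSegment r v := by
    obtain ⟨v, hv, w, hw, h⟩ := S.spanned t
    rcases S.mem_or_mem r h with h | h
    · exact ⟨v, hv, geodesicSegment_comm v r ▸ h⟩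
    · exact ⟨w, hw, h⟩
  obtain ⟨v, hv, hmax⟩ := Finset.exists_max_image
    (S.vertices.filter fun v => t ∈ geodesicSegment r v) (fun v => dist r v)
    ⟨v₀, Finset.mem_filter.mpr ⟨hv₀, ht₀⟩⟩
  obtain ⟨hvV, htv⟩ := Finset.mem_filter.mp hv
  by_contra! hcon
  have hvr : v ≠ r := fun h => hcon r hrA (h ▸ htv)
  have hvl : v ∉ S.leaves := fun h => hcon v (hA h) htv
  obtain ⟨s, hs, hsr⟩ := S.exists_adj hvV hr hvr
  have hne : ∃ q, S.Adj v q ∧ q ≠ s := by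
    by_contra! hq
    refine hvl ⟨hvV, Set.ncard_eq_one.mpr ⟨s, Set.eq_singleton_iff_unique_mem.mpr ⟨hs, hq⟩⟩⟩
  obtain ⟨q, hq, hqs⟩ := hne
  obtain ⟨o, ho1, ho2, ho3⟩ := S.exists_median r v q
  have hoV := S.branch r hr v hvV q hq.2.1 o ho1 ho2 ho3
  rcases hq.2.2.2 o hoV ho2 with h | h
  · subst h
    rw [geodesicSegment_comm] at ho3
    have := hmax q (Finset.mem_filter.mpr ⟨hq.2.1, geodesicSegment_subset_left ho3 htv⟩)
    rw [mem_geodesicSegment_iff] at ho3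
    exact hq.2.2.1 (dist_le_zero.mp (by linarith))
  · subst h
    rw [geodesicSegment_comm] at ho1
    exact hqs (S.adj_unique hq hs ho1 hsr)

end FiniteMetricTree

/-! ### Maps from triangles to trees -/

section TripodLeg

variable {α : Type*} [MetricSpace α]

theorem tripodLeg_add (x : Fin 3 → α) {i j : Fin 3} (hij : i ≠ j) :
    tripodLeg x i + tripodLeg x j = dist (x i) (x j) := by
  have e0 : tripodLeg x 0 = (dist (x 0) (x 1) + dist (x 0) (x 2) - dist (x 1) (x 2)) / 2 := rfl
  have e1 : tripodLeg x 1 = (dist (x 1) (x 2) + dist (x 1) (x 0) - dist (x 2) (x 0)) / 2 := rfl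
  have e2 : tripodLeg x 2 = (dist (x 2) (x 0) + dist (x 2) (x 1) - dist (x 0) (x 1)) / 2 := rfl
  have c1 := dist_comm (x 1) (x 0)
  have c2 := dist_comm (x 2) (x 0)
  have c3 := dist_comm (x 2) (x 1)
  fin_cases i <;> fin_cases j <;> simp at hij ⊢ <;> linarith

/-- The balls about the vertices of a triangle with the tripod legs as radii do not overlap. -/
theorem tripodLeg_add_le (x : Fin 3 → α) {i j : Fin 3} (hij : i ≠ j) (w : α) :
    tripodLeg x i + tripodLeg x j ≤ dist (x i) w + dist (x j) w := by
  rw [tripodLeg_add x hij]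
  exact dist_triangle_right _ _ _

theorem tripodLeg_le_of_mem (x : Fin 3 → α) {i j k : Fin 3} (hij : i ≠ j) (hki : k ≠ i)
    (hkj : k ≠ j) {w : α} (hw : w ∈ geodesicSegment (x i) (x j)) :
    tripodLeg x k ≤ dist (x k) w := by
  have h1 := tripodLeg_add_le x hki w
  have h2 := tripodLeg_add_le x hkj w
  have h3 := tripodLeg_add x hij
  rw [mem_geodesicSegment_iff, dist_comm w] at hw
  linarith

theorem dist_eq_tripodLeg {y : Fin 3 → α} {o : α}
    (ho : ∀ i j, i ≠ j → o ∈ geodesicSegment (y i) (y j)) (i : Fin 3) :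
    dist (y i) o = tripodLeg y i := by
  have h1 := ho 0 1 (by decide)
  have h2 := ho 1 2 (by decide)
  have h3 := ho 2 0 (by decide)
  rw [mem_geodesicSegment_iff, dist_comm o] at h1 h2 h3
  have e0 : tripodLeg y 0 = (dist (y 0) (y 1) + dist (y 0) (y 2) - dist (y 1) (y 2)) / 2 := rfl
  have e1 : tripodLeg y 1 = (dist (y 1) (y 2) + dist (y 1) (y 0) - dist (y 2) (y 0)) / 2 := rfl
  have e2 : tripodLeg y 2 = (dist (y 2) (y 0) + dist (y 2) (y 1) - dist (y 0) (y 1)) / 2 := rfl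
  have c1 := dist_comm (y 1) (y 0)
  have c2 := dist_comm (y 2) (y 0)
  have c3 := dist_comm (y 2) (y 1)
  fin_cases i <;> simp <;> linarith

/-- The comparison map of a triangle. On the leg of `xᵢ` the image of a point of the triangle is
determined by its distance to `xᵢ`, and so this formula makes sense on the ambient space. -/
noncomputable def comparisonMap (x : Fin 3 → α) (w : α) : PiLp 1 (fun _ : Fin 3 => ℝ) :=
  WithLp.toLp 1 fun i => max (tripodLeg x i - dist (x i) w) 0

theorem comparisonMap_apply (x : Fin 3 → α) (w : α) (i : Fin 3) :
    comparisonMap x w i = max (tripodLeg x i - dist (x i) w) 0 := rfl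

theorem comparisonMap_eq_single (x : Fin 3 → α) {w : α} {i : Fin 3}
    (h : dist (x i) w ≤ tripodLeg x i) :
    comparisonMap x w = PiLp.single 1 i (tripodLeg x i - dist (x i) w) := by
  ext j
  rw [comparisonMap_apply]
  by_cases hj : j = i
  · subst hj
    simp [h]
  · have := tripodLeg_add_le x hj w
    rw [max_eq_right (by linarith)]
    simp [hj]

theorem isComparisonMap_comparisonMap {n : ℕ} (x : Fin 3 → HyperbolicSpace n) :
    IsComparisonMap x (comparisonMap x) where
  mapsTo w _ := by
    by_cases h : ∃ i, dist (x i) w ≤ tripodLeg x i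
    · obtain ⟨i, hi⟩ := h
      exact ⟨i, _, sub_nonneg.mpr hi, sub_le_self _ dist_nonneg, comparisonMap_eq_single x hi⟩
    · push Not at h
      refine ⟨0, 0, le_rfl, tripodLeg_nonneg x 0, ?_⟩
      ext j
      rw [comparisonMap_apply, max_eq_right (by linarith [h j])]
      simp
  map_vertex i := by
    rw [comparisonMap_eq_single x (i := i) (by simp [tripodLeg_nonneg])]
    simp [tripodEnd]
  isometry i j z hz w hw := by
    by_cases hij : i = j
    · subst hij
      rw [eq_of_mem_geodesicSegment_self hz, eq_of_mem_geodesicSegment_self hw]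
      simp
    rw [HyperbolicSpace.dist_eq_abs_sub_of_mem_geodesicSegment hz hw, PiLp.dist_eq_of_L1,
      Finset.sum_eq_add i j hij]
    · simp only [comparisonMap_apply, Real.dist_eq]
      rw [mem_geodesicSegment_iff, dist_comm _ (x j)] at hz hw
      have := tripodLeg_add x hij
      have e1 : dist (x j) z = dist (x i) (x j) - dist (x i) z := by linarith
      have e2 : dist (x j) w = dist (x i) (x j) - dist (x i) w := by linarith
      rw [e1, e2, ← this]
      generalize dist (x i) z = r
      generalize dist (x i) w = s
      generalize tripodLeg x i = l
      generalize tripodLeg x j = m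
      rcases max_cases (l - r) 0 with h1 | h1 <;> rcases max_cases (l - s) 0 with h2 | h2 <;>
      rcases max_cases (m - (l + m - r)) 0 with h3 | h3 <;>
      rcases max_cases (m - (l + m - s)) 0 with h4 | h4 <;>
      rw [h1.1, h2.1, h3.1, h4.1] <;>
      rcases abs_cases (r - s) with h5 | h5 <;> rw [h5.1] <;>
      first
        | exfalso; linarith
        | rw [abs_of_nonneg (by linarith), abs_of_nonneg (by linarith)]; linarith
        | rw [abs_of_nonneg (by linarith), abs_of_nonpos (by linarith)]; linarith
        | rw [abs_of_nonpos (by linarith), abs_of_nonneg (by linarith)]; linarith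
    · intro k _ hk
      simp only [comparisonMap_apply]
      rw [max_eq_right, max_eq_right, dist_self]
      · linarith [tripodLeg_le_of_mem x hij hk.1 hk.2 hw]
      · linarith [tripodLeg_le_of_mem x hij hk.1 hk.2 hz]
    · simp
    · simp

end TripodLeg

section TriangleMap

variable {T : Type*} [MetricSpace T]

open Classical in
/-- The point of the segment `[yo]` of a tree at distance `r` from `y`, for `0 ≤ r ≤ dist y o`. -/
noncomputable def FiniteMetricTree.pointAt (S : FiniteMetricTree T) (y o : T) (r : ℝ) : T :=
  if h : 0 ≤ r ∧ r ≤ dist y o then (S.exists_dist_eq y o h.1 h.2).choose else o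

theorem FiniteMetricTree.pointAt_spec (S : FiniteMetricTree T) {y o : T} {r : ℝ} (h0 : 0 ≤ r)
    (hr : r ≤ dist y o) :
    S.pointAt y o r ∈ geodesicSegment y o ∧ dist y (S.pointAt y o r) = r := by
  rw [pointAt, dif_pos ⟨h0, hr⟩]
  exact (S.exists_dist_eq y o h0 hr).choose_spec

variable {α : Type*} [MetricSpace α]

/-- The extension of `xᵢ ↦ yᵢ` to the triangle with vertices `xᵢ` which is a dilation from each
half-side at `xᵢ` to `[yᵢo]`, by a formula which makes sense on the ambient space. -/
noncomputable def triangleMap (S : FiniteMetricTree T) (x : Fin 3 → α) (y : Fin 3 → T) (o : T)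
    (w : α) : T :=
  open Classical in
  if h : ∃ i, dist (x i) w < tripodLeg x i then
    S.pointAt (y h.choose) o
      (dist (y h.choose) o / tripodLeg x h.choose * dist (x h.choose) w)
  else o

variable (S : FiniteMetricTree T) {x : Fin 3 → α} {y : Fin 3 → T} {o : T}

theorem triangleMap_of_lt {w : α} {i : Fin 3} (h : dist (x i) w < tripodLeg x i) :
    triangleMap S x y o w =
      S.pointAt (y i) o (dist (y i) o / tripodLeg x i * dist (x i) w) := by
  have hex : ∃ i, dist (x i) w < tripodLeg x i := ⟨i, h⟩
  have hi : hex.choose = i := by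
    by_contra hne
    have := hex.choose_spec
    have := tripodLeg_add_le x hne w
    linarith
  rw [triangleMap, dif_pos hex, hi]

theorem triangleMap_of_le {w : α} (h : ∀ i, tripodLeg x i ≤ dist (x i) w) :
    triangleMap S x y o w = o := by
  rw [triangleMap, dif_neg]
  push Not
  exact h

theorem triangleMap_spec (hdeg : ∀ i, tripodLeg x i = 0 → y i = o) {w : α} {i : Fin 3}
    (h : dist (x i) w ≤ tripodLeg x i) :
    triangleMap S x y o w ∈ geodesicSegment (y i) o ∧
      dist (y i) (triangleMap S x y o w) = dist (y i) o / tripodLeg x i * dist (x i) w := by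
  have hd := dist_nonneg (x := x i) (y := w)
  rcases h.lt_or_eq with h | h
  · rw [triangleMap_of_lt S h]
    have hl : 0 < tripodLeg x i := hd.trans_lt h
    refine S.pointAt_spec (by positivity) ?_
    calc dist (y i) o / tripodLeg x i * dist (x i) w
        ≤ dist (y i) o / tripodLeg x i * tripodLeg x i := by gcongr
      _ = dist (y i) o := by field_simp
  · rw [triangleMap_of_le S]
    · refine ⟨right_mem_geodesicSegment _ _, ?_⟩
      rw [h]
      by_cases h0 : tripodLeg x i = 0
      · rw [hdeg i h0, h0]
        simp
      · field_simp
    · intro j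
      by_cases hj : j = i
      · subst hj; exact h.ge
      · have := tripodLeg_add_le x hj w
        linarith

theorem triangleMap_vertex (hdeg : ∀ i, tripodLeg x i = 0 → y i = o) (i : Fin 3) :
    triangleMap S x y o (x i) = y i := by
  have h := (triangleMap_spec S hdeg (w := x i) (i := i) (by simp [tripodLeg_nonneg])).2
  rw [dist_self, mul_zero] at h
  exact (dist_eq_zero.mp h).symm

theorem isTriangleMap_triangleMap {n : ℕ} {x : Fin 3 → HyperbolicSpace n}
    (hdeg : ∀ i, tripodLeg x i = 0 → y i = o)
    (ho : ∀ i j, i ≠ j → o ∈ geodesicSegment (y i) (y j)) :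
    IsTriangleMap x y (triangleMap S x y o) := by
  refine ⟨comparisonMap x, o, isComparisonMap_comparisonMap x, ho, triangleMap_vertex S hdeg, ?_⟩
  rintro i j hij z ⟨hz, hχ⟩
  have hle : ∀ k, tripodLeg x k ≤ dist (x k) z := by
    intro k
    have h := comparisonMap_apply x z k
    rw [hχ] at h
    have := le_max_left (tripodLeg x k - dist (x k) z) 0
    rw [← h] at this
    simpa using this
  have hi : dist (x i) z = tripodLeg x i := by
    have := tripodLeg_add x hij
    have := hle i
    have := hle j
    rw [mem_geodesicSegment_iff, dist_comm z] at hz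
    linarith
  refine ⟨triangleMap_of_le S hle, fun w hw => ?_⟩
  rw [hi]
  refine triangleMap_spec S hdeg ?_
  rw [mem_geodesicSegment_iff] at hw
  linarith [dist_nonneg (x := w) (y := z)]

theorem dist_le_tripodLeg_or {i j : Fin 3} (hij : i ≠ j) {w : α}
    (hw : w ∈ geodesicSegment (x i) (x j)) :
    dist (x i) w ≤ tripodLeg x i ∨ dist (x j) w ≤ tripodLeg x j := by
  have := tripodLeg_add x hij
  rw [mem_geodesicSegment_iff, dist_comm w] at hw
  by_contra! h
  linarith

theorem continuousOn_triangleMap (hdeg : ∀ i, tripodLeg x i = 0 → y i = o) {i j : Fin 3}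
    (hij : i ≠ j) :
    ContinuousOn (triangleMap S x y o) (geodesicSegment (x i) (x j)) := by
  have key : ∀ i, ContinuousOn (triangleMap S x y o)
      (Metric.closedBall (x i) (tripodLeg x i)) := by
    intro i
    have hL : 0 ≤ dist (y i) o / tripodLeg x i := div_nonneg dist_nonneg (tripodLeg_nonneg x i)
    refine (LipschitzOnWith.of_dist_le_mul (K := ⟨_, hL⟩) fun w hw w' hw' => ?_).continuousOn
    rw [Metric.mem_closedBall, dist_comm] at hw hw'
    obtain ⟨h1, h2⟩ := triangleMap_spec S hdeg hw
    obtain ⟨h3, h4⟩ := triangleMap_spec S hdeg hw'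
    rw [S.dist_eq_abs_sub h1 h3, h2, h4, ← mul_sub, abs_mul, abs_of_nonneg hL]
    refine mul_le_mul_of_nonneg_left ?_ hL
    rw [dist_comm (x i), dist_comm (x i)]
    exact abs_dist_sub_le w w' (x i)
  refine ((key i).union_of_isClosed (key j) Metric.isClosed_closedBall
    Metric.isClosed_closedBall).mono fun w hw => ?_
  simp only [Set.mem_union, Metric.mem_closedBall]
  rw [dist_comm w, dist_comm w]
  exact dist_le_tripodLeg_or hij hw

theorem exists_triangleMap_eq_of_mem_leg {n : ℕ} {x : Fin 3 → HyperbolicSpace n}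
    (hdeg : ∀ i, tripodLeg x i = 0 → y i = o) {i j : Fin 3} (hij : i ≠ j) {t : T}
    (ht : t ∈ geodesicSegment (y i) o) :
    ∃ z ∈ geodesicSegment (x i) (x j), triangleMap S x y o z = t := by
  have hl := tripodLeg_nonneg x i
  have ht' : dist (y i) t ≤ dist (y i) o := by
    rw [mem_geodesicSegment_iff] at ht
    linarith [dist_nonneg (x := t) (y := o)]
  obtain ⟨r, hr0, hrl, hr⟩ : ∃ r, 0 ≤ r ∧ r ≤ tripodLeg x i ∧
      dist (y i) o / tripodLeg x i * r = dist (y i) t := by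
    by_cases h0 : dist (y i) o = 0
    · have := dist_nonneg (x := y i) (y := t)
      exact ⟨0, le_rfl, hl, by linarith⟩
    · have hne : tripodLeg x i ≠ 0 := fun h => h0 (by rw [hdeg i h, dist_self])
      refine ⟨dist (y i) t / dist (y i) o * tripodLeg x i, by positivity, ?_, by field_simp⟩
      exact mul_le_of_le_one_left hl (div_le_one_of_le₀ ht' dist_nonneg)
  obtain ⟨z, hz, hzr⟩ := HyperbolicSpace.exists_dist_eq_of_le_dist (x i) (x j) hr0
    (by linarith [tripodLeg_add x hij, tripodLeg_nonneg x j])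
  obtain ⟨h1, h2⟩ := triangleMap_spec S hdeg (w := z) (i := i) (hzr.trans_le hrl)
  refine ⟨z, hz, dist_eq_zero.mp ?_⟩
  rw [S.dist_eq_abs_sub h1 ht, h2, hzr, hr, sub_self, abs_zero]

theorem exists_triangleMap_eq {n : ℕ} {x : Fin 3 → HyperbolicSpace n}
    (hdeg : ∀ i, tripodLeg x i = 0 → y i = o) {i j : Fin 3} (hij : i ≠ j) {t : T}
    (ht : t ∈ geodesicSegment (y i) (y j)) :
    ∃ z ∈ geodesicSegment (x i) (x j), triangleMap S x y o z = t := by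
  rcases S.mem_or_mem o ht with h | h
  · exact exists_triangleMap_eq_of_mem_leg S hdeg hij h
  · rw [geodesicSegment_comm] at h ⊢
    exact exists_triangleMap_eq_of_mem_leg S hdeg hij.symm h

/-- `w` is in the same position on `[ab]` as `z` is on `[uv]`, up to the error `K`. -/
def IsCloseOnSegment (K : ℝ) (u v z : α) (a b w : T) : Prop :=
  z ∈ geodesicSegment u v ∧ w ∈ geodesicSegment a b ∧
    |dist a w - dist u z| ≤ K ∧ |dist b w - dist v z| ≤ K

theorem IsCloseOnSegment.symm {K : ℝ} {u v z : α} {a b w : T}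
    (h : IsCloseOnSegment K u v z a b w) : IsCloseOnSegment K v u z b a w :=
  ⟨geodesicSegment_comm u v ▸ h.1, geodesicSegment_comm a b ▸ h.2.1, h.2.2.2, h.2.2.1⟩

theorem isCloseOnSegment_triangleMap {κ : ℝ} (hdeg : ∀ i, tripodLeg x i = 0 → y i = o)
    (ho : ∀ i j, i ≠ j → o ∈ geodesicSegment (y i) (y j))
    (hle : ∀ i j, dist (y i) (y j) ≤ dist (x i) (x j))
    (hge : ∀ i j, dist (x i) (x j) - κ ≤ dist (y i) (y j)) {i j : Fin 3} (hij : i ≠ j) {z : α}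
    (hz : z ∈ geodesicSegment (x i) (x j)) :
    IsCloseOnSegment (2 * κ) (x i) (x j) z (y i) (y j) (triangleMap S x y o z) := by
  wlog h : dist (x i) z ≤ tripodLeg x i generalizing i j
  · have h' := (dist_le_tripodLeg_or hij hz).resolve_left h
    rw [geodesicSegment_comm] at hz
    exact (this hij.symm hz h').symm
  obtain ⟨h1, h2⟩ := triangleMap_spec S hdeg h
  have hmem := geodesicSegment_subset_left (ho i j hij) h1
  have hκ : 0 ≤ κ := by
    have := hge i i
    rw [dist_self, dist_self] at this
    linarith
  have hleg : |tripodLeg y i - tripodLeg x i| ≤ κ := by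
    have a1 := hle i (i + 1)
    have a2 := hle i (i + 2)
    have a3 := hle (i + 1) (i + 2)
    have b1 := hge i (i + 1)
    have b2 := hge i (i + 2)
    have b3 := hge (i + 1) (i + 2)
    unfold tripodLeg
    rw [abs_le]
    constructor <;> linarith
  have hi : |dist (y i) (triangleMap S x y o z) - dist (x i) z| ≤ κ := by
    rw [h2, dist_eq_tripodLeg ho]
    rcases (tripodLeg_nonneg x i).eq_or_lt with h0 | h0
    · have : dist (x i) z = 0 := le_antisymm (by linarith) dist_nonneg
      rw [this]
      simpa using hκ
    · have e : tripodLeg y i / tripodLeg x i * dist (x i) z - dist (x i) z =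
          (tripodLeg y i - tripodLeg x i) * (dist (x i) z / tripodLeg x i) := by
        field_simp
      rw [e, abs_mul, abs_of_nonneg (div_nonneg dist_nonneg h0.le)]
      exact (mul_le_of_le_one_right (abs_nonneg _) (div_le_one_of_le₀ h h0.le)).trans hleg
  refine ⟨hz, hmem, by linarith, ?_⟩
  rw [mem_geodesicSegment_iff, dist_comm _ (y j)] at hmem
  rw [mem_geodesicSegment_iff, dist_comm _ (x j)] at hz
  have := hle i j
  have := hge i j
  rw [abs_le] at hi ⊢
  constructor <;> linarith

/-- A map which is close on segments to a map of the end points is almost isometric: in a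
hyperbolic space the distance of `z ∈ [u₀u₁]` and `w ∈ [v₀v₁]` is, up to `4 log 2`, the maximum of
`dist uᵢ vⱼ - dist uᵢ z - dist vⱼ w`, and in a tree it is equal to that maximum. -/
theorem abs_dist_sub_dist_le_of_isCloseOnSegment (S : FiniteMetricTree T) {n : ℕ} {κ K : ℝ}
    {u v z w : HyperbolicSpace n} {u' v' : HyperbolicSpace n} {a b c d r s : T}
    (h₁ : IsCloseOnSegment K u u' z a b r) (h₂ : IsCloseOnSegment K v v' w c d s)
    (e₁ : |dist a c - dist u v| ≤ κ) (e₂ : |dist a d - dist u v'| ≤ κ)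
    (e₃ : |dist b c - dist u' v| ≤ κ) (e₄ : |dist b d - dist u' v'| ≤ κ) :
    |dist r s - dist z w| ≤ κ + 2 * K + 4 * Real.log 2 := by
  obtain ⟨hz, hr, p1, p2⟩ := h₁
  obtain ⟨hw, hs, p3, p4⟩ := h₂
  rw [mem_geodesicSegment_iff] at hz hr hw hs
  rw [abs_le] at p1 p2 p3 p4 e₁ e₂ e₃ e₄
  have hlog := Real.log_pos one_lt_two
  have c1 := dist_comm z u'
  have c2 := dist_comm r b
  have c3 := dist_comm w v'
  have c4 := dist_comm s d
  rw [abs_le]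
  constructor
  · -- the distance in `ℍⁿ` is at most the maximum plus `4 log 2`
    have t1 : dist a c ≤ dist a r + dist r s + dist s c := dist_triangle4 _ _ _ _
    have t2 : dist a d ≤ dist a r + dist r s + dist s d := dist_triangle4 _ _ _ _
    have t3 : dist b c ≤ dist b r + dist r s + dist s c := dist_triangle4 _ _ _ _
    have t4 : dist b d ≤ dist b r + dist r s + dist s d := dist_triangle4 _ _ _ _
    have f0 := HyperbolicSpace.four_point z w u u'
    have f1 := HyperbolicSpace.four_point u w v v'
    have f2 := HyperbolicSpace.four_point u' w v v'
    have d1 := dist_comm w u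
    have d2 := dist_comm w u'
    have d3 := dist_comm w v
    have d4 := dist_comm z u
    have d5 := dist_comm s c
    rw [← sub_le_iff_le_add] at f0 f1 f2
    rcases le_max_iff.mp f0 with g0 | g0 <;> rcases le_max_iff.mp f1 with g1 | g1 <;>
      rcases le_max_iff.mp f2 with g2 | g2 <;> linarith
  · -- the distance in the tree is at most the maximum
    have t1 : dist u v ≤ dist u z + dist z w + dist w v := dist_triangle4 _ _ _ _
    have t2 : dist u v' ≤ dist u z + dist z w + dist w v' := dist_triangle4 _ _ _ _
    have t3 : dist u' v ≤ dist u' z + dist z w + dist w v := dist_triangle4 _ _ _ _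
    have t4 : dist u' v' ≤ dist u' z + dist z w + dist w v' := dist_triangle4 _ _ _ _
    have f0 := S.four_point r s a b
    have f1 := S.four_point a s c d
    have f2 := S.four_point b s c d
    have d1 := dist_comm s a
    have d2 := dist_comm s b
    have d3 := dist_comm s c
    have d4 := dist_comm r a
    have d5 := dist_comm w v
    rcases le_max_iff.mp f0 with g0 | g0 <;> rcases le_max_iff.mp f1 with g1 | g1 <;>
      rcases le_max_iff.mp f2 with g2 | g2 <;> linarith

end TriangleMap

/-! ### Triangles over the edges of the hull -/

theorem IsNondegenerate.notMem_geodesicSegment {α : Type*} [MetricSpace α] {x : Fin 3 → α}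
    (h : IsNondegenerate x) :
    x 0 ∉ geodesicSegment (x 1) (x 2) ∧ x 1 ∉ geodesicSegment (x 0) (x 2) ∧
      x 2 ∉ geodesicSegment (x 0) (x 1) := by
  have e0 : tripodLeg x 0 = (dist (x 0) (x 1) + dist (x 0) (x 2) - dist (x 1) (x 2)) / 2 := rfl
  have e1 : tripodLeg x 1 = (dist (x 1) (x 2) + dist (x 1) (x 0) - dist (x 2) (x 0)) / 2 := rfl
  have e2 : tripodLeg x 2 = (dist (x 2) (x 0) + dist (x 2) (x 1) - dist (x 0) (x 1)) / 2 := rfl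
  have c1 := dist_comm (x 1) (x 0)
  have c2 := dist_comm (x 2) (x 0)
  have c3 := dist_comm (x 2) (x 1)
  have := h 0
  have := h 1
  have := h 2
  simp only [mem_geodesicSegment_iff]
  refine ⟨fun h => ?_, fun h => ?_, fun h => ?_⟩ <;> linarith

/-- If there is a nondegenerate triangle at all, then not all points lie on the geodesic through
`a` and `b`, and so `[ab]` is a side of a nondegenerate triangle. -/
theorem HyperbolicSpace.exists_isNondegenerate {n : ℕ} {X : Finset (HyperbolicSpace n)}
    {x' : Fin 3 → X} (hx' : IsNondegenerate x') {a b : X} (hab : a ≠ b) :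
    ∃ w : X, IsNondegenerate ![a, b, w] := by
  by_contra! hcon
  have hne : (a : HyperbolicSpace n) ≠ b := fun h => hab (Subtype.ext h)
  have hspan : ∀ w : X, InSpan (a : HyperbolicSpace n) b w := by
    intro w
    have h := hcon w
    unfold IsNondegenerate at h
    push Not at h
    obtain ⟨i, hi⟩ := h
    have c1 := dist_comm (b : HyperbolicSpace n) a
    have c2 := dist_comm (w : HyperbolicSpace n) a
    have c3 := dist_comm (w : HyperbolicSpace n) b
    have t1 := dist_triangle (a : HyperbolicSpace n) b w
    have t2 := dist_triangle (b : HyperbolicSpace n) a w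
    have t3 := dist_triangle (a : HyperbolicSpace n) w b
    fin_cases i
    · refine (inSpan_of_mem_geodesicSegment' hne.symm (z := (w : HyperbolicSpace n)) ?_).symm
      have hi : (dist (a : HyperbolicSpace n) b + dist (a : HyperbolicSpace n) w
        - dist (b : HyperbolicSpace n) w) / 2 ≤ 0 := hi
      rw [mem_geodesicSegment_iff]
      linarith
    · refine inSpan_of_mem_geodesicSegment' hne ?_
      have hi : (dist (b : HyperbolicSpace n) w + dist (b : HyperbolicSpace n) a
        - dist (w : HyperbolicSpace n) a) / 2 ≤ 0 := hi
      rw [mem_geodesicSegment_iff]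
      linarith
    · refine inSpan_of_mem_geodesicSegment hne ?_
      have hi : (dist (w : HyperbolicSpace n) a + dist (w : HyperbolicSpace n) b
        - dist (a : HyperbolicSpace n) b) / 2 ≤ 0 := hi
      rw [mem_geodesicSegment_iff]
      linarith
  have h := hx'.notMem_geodesicSegment
  rcases mem_geodesicSegment_of_inSpan (hspan (x' 0)) (hspan (x' 1)) (hspan (x' 2))
    with h' | h' | h'
  · exact h.1 h'
  · exact h.2.1 h'
  · exact h.2.2 h'

section EdgeMap

variable {n : ℕ} {X : Finset (HyperbolicSpace n)} {T : Type*} [MetricSpace T]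

/-- `φ` is a triangle map for a triangle in `X` with side `[ab]`, nondegenerate if possible, which
is continuous on `[ab]`, maps `[ab]` onto `[p(a)p(b)]` and is almost isometric there. -/
structure IsEdgeMap (κ : ℝ) (p : X → T) (a b : X) (φ : HyperbolicSpace n → T) : Prop where
  exists_triangle : ∃ x : Fin 3 → X,
    ((∃ x' : Fin 3 → X, IsNondegenerate x') → IsNondegenerate x) ∧ x 0 = a ∧ x 1 = b ∧
      IsTriangleMap (fun i => (x i : HyperbolicSpace n)) (fun i => p (x i)) φ
  continuousOn : ContinuousOn φ (geodesicSegment (a : HyperbolicSpace n) b)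
  surjOn : Set.SurjOn φ (geodesicSegment (a : HyperbolicSpace n) b) (geodesicSegment (p a) (p b))
  isClose : ∀ z ∈ geodesicSegment (a : HyperbolicSpace n) b,
    IsCloseOnSegment (2 * κ) (a : HyperbolicSpace n) b z (p a) (p b) (φ z)

theorem IsEdgeMap.map_left {κ : ℝ} {p : X → T} {a b : X} {φ : HyperbolicSpace n → T}
    (h : IsEdgeMap κ p a b φ) : φ a = p a := by
  obtain ⟨x, _, rfl, _, χ, o, _, _, hv, _⟩ := h.exists_triangle
  exact hv 0

theorem IsEdgeMap.map_right {κ : ℝ} {p : X → T} {a b : X} {φ : HyperbolicSpace n → T}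
    (h : IsEdgeMap κ p a b φ) : φ b = p b := by
  obtain ⟨x, _, _, rfl, χ, o, _, _, hv, _⟩ := h.exists_triangle
  exact hv 1

theorem exists_isEdgeMap (S : FiniteMetricTree T) {κ : ℝ} {p : X → T}
    (hle : ∀ x₁ x₂, dist (p x₁) (p x₂) ≤ dist x₁ x₂)
    (hge : ∀ x₁ x₂, dist x₁ x₂ - κ ≤ dist (p x₁) (p x₂)) {a b : X} (hab : a ≠ b) :
    ∃ φ, IsEdgeMap κ p a b φ := by
  -- The triangle map exists if each vertex with a leg of length zero is mapped to the median `o`.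
  -- Without a nondegenerate triangle, the degenerate triangle `a`, `b`, `a` has this property.
  suffices H : ∃ x : Fin 3 → X, ∃ o : T, x 0 = a ∧ x 1 = b ∧
      ((∃ x' : Fin 3 → X, IsNondegenerate x') → IsNondegenerate x) ∧
      (∀ i, tripodLeg x i = 0 → p (x i) = o) ∧
      ∀ i j, i ≠ j → o ∈ geodesicSegment (p (x i)) (p (x j)) by
    obtain ⟨x, o, rfl, rfl, hx, hdeg, ho⟩ := H
    exact ⟨triangleMap S (fun i => (x i : HyperbolicSpace n)) (fun i => p (x i)) o,
      ⟨x, hx, rfl, rfl, isTriangleMap_triangleMap S hdeg ho⟩,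
      continuousOn_triangleMap S (x := fun i => (x i : HyperbolicSpace n)) hdeg zero_ne_one,
      fun t ht => exists_triangleMap_eq S (x := fun i => (x i : HyperbolicSpace n))
        (y := fun i => p (x i)) hdeg (i := 0) (j := 1) zero_ne_one ht,
      fun z hz => isCloseOnSegment_triangleMap S (x := fun i => (x i : HyperbolicSpace n))
        (y := fun i => p (x i)) hdeg ho (fun i j => hle _ _) (fun i j => hge _ _)
        (i := 0) (j := 1) zero_ne_one hz⟩
  have hmed : ∀ x : Fin 3 → X, ∃ o : T,
      ∀ i j, i ≠ j → o ∈ geodesicSegment (p (x i)) (p (x j)) := by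
    intro x
    obtain ⟨o, h1, h2, h3⟩ := S.exists_median (p (x 0)) (p (x 1)) (p (x 2))
    refine ⟨o, fun i j hij => ?_⟩
    fin_cases i <;> fin_cases j <;>
      first
        | exact absurd rfl hij
        | assumption
        | (rw [geodesicSegment_comm]; assumption)
  by_cases hX : ∃ x' : Fin 3 → X, IsNondegenerate x'
  · obtain ⟨x', hx'⟩ := hX
    obtain ⟨w, hw⟩ := HyperbolicSpace.exists_isNondegenerate hx' hab
    obtain ⟨o, ho⟩ := hmed ![a, b, w]
    exact ⟨![a, b, w], o, rfl, rfl, fun _ => hw, fun i hi => absurd hi (hw i).ne', ho⟩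
  · obtain ⟨o, ho⟩ := hmed ![a, b, a]
    refine ⟨![a, b, a], o, rfl, rfl, fun h => absurd h hX, fun i hi => ?_, ho⟩
    have hoa : p a = o := (eq_of_mem_geodesicSegment_self (ho 0 2 (by decide))).symm
    fin_cases i
    · exact hoa
    · exfalso
      have hi : (dist b a + dist b a - dist a a) / 2 = 0 := hi
      rw [dist_self, dist_comm] at hi
      have := dist_pos.mpr hab
      linarith
    · exact hoa

end EdgeMap

/-! ### The star of a point -/

section Star

variable {n : ℕ} {X : Finset (HyperbolicSpace n)}

theorem HyperbolicSpace.mem_or_mem_of_mem {v w s t : HyperbolicSpace n}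
    (hs : s ∈ geodesicSegment v w) (ht : t ∈ geodesicSegment v w) :
    s ∈ geodesicSegment v t ∨ t ∈ geodesicSegment v s := by
  have h := HyperbolicSpace.dist_eq_abs_sub_of_mem_geodesicSegment hs ht
  simp only [mem_geodesicSegment_iff]
  rcases abs_cases (dist v s - dist v t) with ⟨h', _⟩ | ⟨h', _⟩
  · right; rw [dist_comm t s]; linarith
  · left; linarith

/-- `u` and `y` are consecutive points of `X` on a segment which starts at `a`. -/
structure IsConsecutive (X : Finset (HyperbolicSpace n)) (a u y : HyperbolicSpace n) : Prop where
  ne : u ≠ y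
  mem : u ∈ geodesicSegment a y
  eq_or_eq : ∀ v ∈ X, v ∈ geodesicSegment u y → v = u ∨ v = y

theorem IsConsecutive.unique {a u y u' y' z : HyperbolicSpace n} (ha : a ∈ X) (hu : u ∈ X)
    (hy : y ∈ X) (hu' : u' ∈ X) (hy' : y' ∈ X) (h : IsConsecutive X a u y)
    (h' : IsConsecutive X a u' y') (hzX : z ∉ X) (hz : z ∈ geodesicSegment u y)
    (hz' : z ∈ geodesicSegment u' y') : u = u' ∧ y = y' := by
  have hza := geodesicSegment_subset_right h.mem hz
  have hza' := geodesicSegment_subset_right h'.mem hz'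
  have haz : a ≠ z := fun e => hzX (e ▸ ha)
  wlog hyy : y ∈ geodesicSegment a y' generalizing u y u' y'
  · have hyy' :=
      (HyperbolicSpace.mem_geodesicSegment_or_mem_geodesicSegment haz hza hza').resolve_left hyy
    obtain ⟨e1, e2⟩ := this hu' hy' hu hy h' h hz' hz hza' hza hyy'
    exact ⟨e1.symm, e2.symm⟩
  have between : ∀ {v w s : HyperbolicSpace n}, v ∈ geodesicSegment a w → s ∈ geodesicSegment v w →
      v ∈ geodesicSegment a s := by
    intro v w s hv hs
    rw [geodesicSegment_comm] at hv hs ⊢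
    exact (mem_geodesicSegment_trans hv hs).2
  have e : y = y' := by
    rcases HyperbolicSpace.mem_or_mem_of_mem hyy h'.mem with h1 | h1
    · -- here `z` lies between `u'` and `y`, which lies between `a` and `u'`
      have h2 := between h'.mem hz'
      have h3 := geodesicSegment_subset_left h2 h1
      exact absurd (eq_of_mem_geodesicSegment_of_mem h3 hza ▸ hy) hzX
    · rcases h'.eq_or_eq y hy (mem_geodesicSegment_trans hyy h1).2 with h2 | h2
      · have h3 := between h'.mem hz'
        rw [← h2] at h3
        exact absurd (eq_of_mem_geodesicSegment_of_mem h3 hza ▸ hy) hzX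
      · exact h2
  subst e
  refine ⟨?_, rfl⟩
  rcases HyperbolicSpace.mem_or_mem_of_mem h.mem h'.mem with h1 | h1
  · exact ((h.eq_or_eq u' hu' (mem_geodesicSegment_trans h'.mem h1).2).resolve_right h'.ne).symm
  · exact (h'.eq_or_eq u hu (mem_geodesicSegment_trans h.mem h1).2).resolve_right h.ne

theorem exists_isConsecutive_of_mem {a b z : HyperbolicSpace n} (ha : a ∈ X) (hb : b ∈ X)
    (hzX : z ∉ X) (hz : z ∈ geodesicSegment a b) :
    ∃ u ∈ X, ∃ y ∈ X, IsConsecutive X a u y ∧ z ∈ geodesicSegment u y := by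
  classical
  obtain ⟨y, hy, hmin⟩ := Finset.exists_min_image
    (X.filter fun v => z ∈ geodesicSegment a v) (fun v => dist a v)
    ⟨b, Finset.mem_filter.mpr ⟨hb, hz⟩⟩
  obtain ⟨hyX, hzy⟩ := Finset.mem_filter.mp hy
  obtain ⟨u, hu, hmax⟩ := Finset.exists_max_image
    (X.filter fun v => v ∈ geodesicSegment a z) (fun v => dist a v)
    ⟨a, Finset.mem_filter.mpr ⟨ha, left_mem_geodesicSegment a z⟩⟩
  obtain ⟨huX, huz⟩ := Finset.mem_filter.mp hu
  obtain ⟨huy, hzuy⟩ := mem_geodesicSegment_trans hzy huz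
  refine ⟨u, huX, y, hyX, ⟨?_, huy, fun v hv hvuy => ?_⟩, hzuy⟩
  · rintro rfl
    exact hzX (eq_of_mem_geodesicSegment_self hzuy ▸ huX)
  · have hvay := geodesicSegment_subset_right huy hvuy
    rcases HyperbolicSpace.mem_or_mem_of_mem hvay hzy with h | h
    · have := hmax v (Finset.mem_filter.mpr ⟨hv, h⟩)
      simp only [mem_geodesicSegment_iff] at hvuy huy hvay
      exact Or.inl (dist_le_zero.mp (by linarith [dist_comm u v]))
    · have := hmin v (Finset.mem_filter.mpr ⟨hv, h⟩)
      rw [mem_geodesicSegment_iff] at hvay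
      exact Or.inr (dist_le_zero.mp (by linarith))

theorem exists_isConsecutive_right {a y : HyperbolicSpace n} (ha : a ∈ X) (hay : a ≠ y) :
    ∃ u ∈ X, IsConsecutive X a u y := by
  classical
  obtain ⟨u, hu, hmax⟩ := Finset.exists_max_image
    (X.filter fun v => v ∈ geodesicSegment a y ∧ v ≠ y) (fun v => dist a v)
    ⟨a, Finset.mem_filter.mpr ⟨ha, left_mem_geodesicSegment a y, hay⟩⟩
  obtain ⟨huX, huy, hne⟩ := Finset.mem_filter.mp hu
  refine ⟨u, huX, hne, huy, fun v hv hvuy => ?_⟩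
  by_cases hvy : v = y
  · exact Or.inr hvy
  · have hvay := geodesicSegment_subset_right huy hvuy
    have := hmax v (Finset.mem_filter.mpr ⟨hv, hvay, hvy⟩)
    simp only [mem_geodesicSegment_iff] at hvuy huy hvay
    exact Or.inl (dist_le_zero.mp (by linarith [dist_comm u v]))

end Star

/-! ### The map from the hull to an approximating tree -/

section HullMap

variable {n : ℕ} {X : Finset (HyperbolicSpace n)} {T : Type*}

theorem isQuasiIsometry_of_surjective {α β : Type*} [MetricSpace α] [MetricSpace β] {A : ℝ}
    {f : α → β} (hf : Function.Surjective f)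
    (h : ∀ z w, |dist (f z) (f w) - dist z w| ≤ A) : IsQuasiIsometry 1 A f := by
  refine ⟨fun z w => ?_, Function.surjInv hf, fun y₁ y₂ => ?_, fun z => ?_, fun y => ?_⟩
  · have := abs_le.mp (h z w)
    constructor <;> linarith
  · have := abs_le.mp (h (Function.surjInv hf y₁) (Function.surjInv hf y₂))
    rw [Function.surjInv_eq hf, Function.surjInv_eq hf] at this
    constructor <;> linarith
  · have := abs_le.mp (h z (Function.surjInv hf (f z)))
    rw [Function.surjInv_eq hf, dist_self] at this
    linarith
  · have := h (Function.surjInv hf y) (Function.surjInv hf y)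
    rw [Function.surjInv_eq hf, dist_self]
    exact (abs_nonneg _).trans this

/-- A choice of one edge through each point of the hull: for the points of the star of `a` it is the
edge between consecutive points of `X` on a segment from `a`, so that the chosen edge maps fit
together along the star. -/
theorem exists_map_of_edgeMaps (a : X) (p : X → T) (φ : X → X → HyperbolicSpace n → T)
    (hφ : ∀ u y, u ≠ y → φ u y u = p u ∧ φ u y y = p y) :
    ∃ P : quasiConvexHull X → T,
      (∀ x : X, P ⟨x, mem_quasiConvexHull x⟩ = p x) ∧
      (∀ z : quasiConvexHull X, (z : HyperbolicSpace n) ∉ X → ∃ u y : X, u ≠ y ∧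
        (z : HyperbolicSpace n) ∈ geodesicSegment (u : HyperbolicSpace n) y ∧ P z = φ u y z) ∧
      ∀ u y : X, IsConsecutive X (a : HyperbolicSpace n) u y → ∀ z : quasiConvexHull X,
        (z : HyperbolicSpace n) ∈ geodesicSegment (u : HyperbolicSpace n) y → P z = φ u y z := by
  classical
  have H : ∀ z : quasiConvexHull X, (z : HyperbolicSpace n) ∉ X → ∃ u y : X, u ≠ y ∧
      (z : HyperbolicSpace n) ∈ geodesicSegment (u : HyperbolicSpace n) y ∧
      ∀ u' y' : X, IsConsecutive X (a : HyperbolicSpace n) u' y' →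
        (z : HyperbolicSpace n) ∈ geodesicSegment (u' : HyperbolicSpace n) y' →
        u = u' ∧ y = y' := by
    intro z hzX
    by_cases h : ∃ u y : X, IsConsecutive X (a : HyperbolicSpace n) u y ∧
        (z : HyperbolicSpace n) ∈ geodesicSegment (u : HyperbolicSpace n) y
    · obtain ⟨u, y, h, hz⟩ := h
      refine ⟨u, y, fun e => h.ne (congrArg _ e), hz, fun u' y' h' hz' => ?_⟩
      obtain ⟨e1, e2⟩ := h.unique a.2 u.2 y.2 u'.2 y'.2 h' hzX hz hz'
      exact ⟨Subtype.ext e1, Subtype.ext e2⟩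
    · have hz := z.2
      simp only [quasiConvexHull, Set.mem_iUnion] at hz
      obtain ⟨u, hu, y, hy, hz⟩ := hz
      refine ⟨⟨u, hu⟩, ⟨y, hy⟩, ?_, hz, fun u' y' h' hz' => absurd ⟨u', y', h', hz'⟩ h⟩
      intro e
      have e : u = y := congrArg Subtype.val e
      subst e
      exact hzX (eq_of_mem_geodesicSegment_self hz ▸ hu)
  choose U Y hne hmem huniq using H
  refine ⟨fun z => if h : (z : HyperbolicSpace n) ∈ X then p ⟨z, h⟩ else φ (U z h) (Y z h) z,
    fun x => ?_, fun z hz => ⟨U z hz, Y z hz, hne z hz, hmem z hz, ?_⟩, fun u y h z hz => ?_⟩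
  · simp
  · simp [hz]
  · by_cases hzX : (z : HyperbolicSpace n) ∈ X
    · have huy : u ≠ y := fun e => h.ne (congrArg _ e)
      simp only [hzX, dif_pos]
      rcases h.eq_or_eq z hzX hz with e | e
      · exact (congrArg p (Subtype.ext e)).trans
          ((hφ u y huy).1.symm.trans (congrArg (φ u y) e.symm))
      · exact (congrArg p (Subtype.ext e)).trans
          ((hφ u y huy).2.symm.trans (congrArg (φ u y) e.symm))
    · obtain ⟨e1, e2⟩ := huniq z hzX u y h hz
      simp [hzX, e1, e2]

variable [MetricSpace T]

/-- Along an edge `[ab]` the hull map is made of the edge maps between consecutive points. -/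
theorem continuousOn_hullMap {a b : X} {φ : X → X → HyperbolicSpace n → T}
    (hφ : ∀ u y : X, u ≠ y →
      ContinuousOn (φ u y) (geodesicSegment (u : HyperbolicSpace n) y))
    {P : quasiConvexHull X → T}
    (hP : ∀ u y : X, IsConsecutive X (a : HyperbolicSpace n) u y → ∀ z : quasiConvexHull X,
      (z : HyperbolicSpace n) ∈ geodesicSegment (u : HyperbolicSpace n) y → P z = φ u y z) :
    ContinuousOn P {z | (z : HyperbolicSpace n) ∈ geodesicSegment (a : HyperbolicSpace n) b} := by
  let C : X ⊕ {e : X × X // IsConsecutive X (a : HyperbolicSpace n) e.1 e.2} →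
      Set (quasiConvexHull X) :=
    Sum.elim (fun x => {z | (z : HyperbolicSpace n) = x})
      fun e => {z | (z : HyperbolicSpace n) ∈ geodesicSegment (e.1.1 : HyperbolicSpace n) e.1.2}
  have hC : ContinuousOn P (⋃ i, C i) := by
    have : Finite {e : X × X // IsConsecutive X (a : HyperbolicSpace n) e.1 e.2} :=
      Subtype.finite
    refine (locallyFinite_of_finite C).continuousOn_iUnion ?_ ?_
    · rintro (x | e)
      · exact isClosed_eq continuous_subtype_val continuous_const
      · exact (isClosed_geodesicSegment _ _).preimage continuous_subtype_val
    · rintro (x | ⟨⟨u, y⟩, h⟩)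
      · refine Set.Subsingleton.continuousOn (fun z hz w hw => Subtype.ext ?_) P
        exact Eq.trans hz (Eq.symm hw)
      · have huy : u ≠ y := fun e => h.ne (congrArg _ e)
        refine ContinuousOn.congr (f := fun z : quasiConvexHull X => φ u y z) ?_ (hP u y h)
        exact (hφ u y huy).comp continuous_subtype_val.continuousOn fun z hz => hz
  refine hC.mono fun z hz => Set.mem_iUnion.mpr ?_
  by_cases hzX : (z : HyperbolicSpace n) ∈ X
  · exact ⟨Sum.inl ⟨z, hzX⟩, rfl⟩
  · obtain ⟨u, hu, y, hy, h, hzuy⟩ := exists_isConsecutive_of_mem a.2 b.2 hzX hz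
    exact ⟨Sum.inr ⟨(⟨u, hu⟩, ⟨y, hy⟩), h⟩, hzuy⟩

/-- Every point `t` of the tree lies on a segment `[p(a)p(y)]`. If `y` is chosen as close to `a` as
possible and `u` is the point of `X` that precedes `y` on `[ay]`, then `t` lies on `[p(u)p(y)]`. -/
theorem surjective_hullMap (S : FiniteMetricTree T) {p : X → T} (hv : ∀ x, p x ∈ S.vertices)
    (hl : S.leaves ⊆ Set.range p) {a : X} {φ : X → X → HyperbolicSpace n → T}
    (hφ : ∀ u y : X, u ≠ y → Set.SurjOn (φ u y) (geodesicSegment (u : HyperbolicSpace n) y)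
      (geodesicSegment (p u) (p y)))
    {P : quasiConvexHull X → T} (hPX : ∀ x : X, P ⟨x, mem_quasiConvexHull x⟩ = p x)
    (hP : ∀ u y : X, IsConsecutive X (a : HyperbolicSpace n) u y → ∀ z : quasiConvexHull X,
      (z : HyperbolicSpace n) ∈ geodesicSegment (u : HyperbolicSpace n) y → P z = φ u y z) :
    Function.Surjective P := by
  classical
  intro t
  obtain ⟨_, ⟨y₀, rfl⟩, hy₀⟩ :=
    S.exists_mem_geodesicSegment_of_leaves_subset (hv a) (Set.mem_range_self a) hl t
  obtain ⟨y, hy, hmin⟩ := Finset.exists_min_image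
    (Finset.univ.filter fun y : X => t ∈ geodesicSegment (p a) (p y)) (fun y => dist a y)
    ⟨y₀, Finset.mem_filter.mpr ⟨Finset.mem_univ _, hy₀⟩⟩
  have hty := (Finset.mem_filter.mp hy).2
  by_cases hay : a = y
  · subst hay
    exact ⟨⟨a, mem_quasiConvexHull a⟩, (hPX a).trans (eq_of_mem_geodesicSegment_self hty).symm⟩
  obtain ⟨u, hu, h⟩ := exists_isConsecutive_right a.2 (fun e => hay (Subtype.ext e))
  lift u to X using hu
  have huy : u ≠ y := fun e => h.ne (congrArg _ e)
  rcases S.mem_or_mem (p u) hty with h' | h'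
  · exfalso
    have h1 := hmin u (Finset.mem_filter.mpr ⟨Finset.mem_univ _, h'⟩)
    have h2 : dist a u + dist u y = dist a y := h.mem
    exact huy (dist_le_zero.mp (by linarith))
  · obtain ⟨z, hz, hzt⟩ := hφ u y huy h'
    have hzQ : z ∈ quasiConvexHull X := by
      simp only [quasiConvexHull, Set.mem_iUnion]
      exact ⟨u, u.2, y, y.2, hz⟩
    exact ⟨⟨z, hzQ⟩, (hP u y h ⟨z, hzQ⟩ hz).trans hzt⟩

theorem exists_triangle_of_mem (S : FiniteMetricTree T) {p : X → T}
    {φ : X → X → HyperbolicSpace n → T} {κ : ℝ}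
    (hφ : ∀ u y : X, u ≠ y → IsEdgeMap κ p u y (φ u y)) (z : X) :
    ∃ x : Fin 3 → X, ((∃ x' : Fin 3 → X, IsNondegenerate x') → IsNondegenerate x) ∧
      (z : HyperbolicSpace n) ∈ triangle (fun i => (x i : HyperbolicSpace n)) ∧
      ∃ ψ : HyperbolicSpace n → T,
        IsTriangleMap (fun i => (x i : HyperbolicSpace n)) (fun i => p (x i)) ψ ∧ p z = ψ z := by
  by_cases h : ∃ y, z ≠ y
  · obtain ⟨y, hy⟩ := h
    have hE := hφ z y hy
    obtain ⟨x, hx, h0, h1, hmap⟩ := hE.exists_triangle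
    refine ⟨x, hx, Set.mem_iUnion₂.mpr ⟨0, 0, ?_⟩, φ z y, hmap, hE.map_left.symm⟩
    change (z : HyperbolicSpace n) ∈ geodesicSegment (x 0 : HyperbolicSpace n) (x 0)
    rw [h0]
    exact left_mem_geodesicSegment _ _
  · push Not at h
    refine ⟨fun _ => z, ?_, Set.mem_iUnion₂.mpr ⟨0, 0, left_mem_geodesicSegment _ _⟩,
      triangleMap S (fun _ => (z : HyperbolicSpace n)) (fun _ => p z) (p z),
      isTriangleMap_triangleMap S (fun _ _ => rfl) (fun _ _ _ => left_mem_geodesicSegment _ _), ?_⟩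
    · rintro ⟨x', hx'⟩
      exact absurd (by rw [← h (x' 0), ← h (x' 1)]; exact left_mem_geodesicSegment _ _)
        hx'.notMem_geodesicSegment.1
    · exact (triangleMap_vertex S (x := fun _ => (z : HyperbolicSpace n)) (y := fun _ => p z)
        (fun _ _ => rfl) 0).symm

theorem IsGromovApproximatingTree.exists_hullMap {c : ℝ} (hc : 0 < c) {S : FiniteMetricTree T}
    {p : X → T} (h : IsGromovApproximatingTree c X S p) (a b : X) :
    ∃ P : quasiConvexHull X → T,
      ContinuousOn P {z | (z : HyperbolicSpace n) ∈ geodesicSegment (a : HyperbolicSpace n) b} ∧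
      (∀ z : quasiConvexHull X, ∃ x : Fin 3 → X,
        ((∃ x' : Fin 3 → X, IsNondegenerate x') → IsNondegenerate x) ∧
        (z : HyperbolicSpace n) ∈ triangle (fun i => (x i : HyperbolicSpace n)) ∧
        ∃ φ : HyperbolicSpace n → T,
          IsTriangleMap (fun i => (x i : HyperbolicSpace n)) (fun i => p (x i)) φ ∧ P z = φ z) ∧
      (∀ x : X, P ⟨x, mem_quasiConvexHull x⟩ = p x) ∧
      Function.Surjective P ∧
      IsQuasiIsometry 1 ((20 * c + 12) * Real.log 3) P := by
  have H : ∀ u y : X, ∃ φ, u ≠ y → IsEdgeMap (2 * c * Real.log 3) p u y φ := by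
    intro u y
    by_cases huy : u = y
    · exact ⟨fun _ => p a, fun h => absurd huy h⟩
    · obtain ⟨φ, hφ⟩ := exists_isEdgeMap S h.dist_le h.le_dist huy
      exact ⟨φ, fun _ => hφ⟩
  choose φ hφ using H
  obtain ⟨P, hPX, hPe, hPc⟩ :=
    exists_map_of_edgeMaps a p φ fun u y huy => ⟨(hφ u y huy).map_left, (hφ u y huy).map_right⟩
  have hsurj := surjective_hullMap S h.map_vertices h.leaves_subset
    (fun u y huy => (hφ u y huy).surjOn) hPX hPc
  have hlog2 := Real.log_pos one_lt_two
  have hlog : Real.log 2 ≤ Real.log 3 := Real.log_le_log two_pos (by norm_num)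
  refine ⟨P, continuousOn_hullMap (fun u y huy => (hφ u y huy).continuousOn) hPc, fun z => ?_,
    hPX, hsurj, isQuasiIsometry_of_surjective hsurj fun z w => ?_⟩
  · by_cases hzX : (z : HyperbolicSpace n) ∈ X
    · obtain ⟨x, hx, hz, ψ, hψ, hpz⟩ := exists_triangle_of_mem S hφ ⟨z, hzX⟩
      exact ⟨x, hx, hz, ψ, hψ, (hPX ⟨z, hzX⟩).trans hpz⟩
    · obtain ⟨u, y, huy, hz, hPz⟩ := hPe z hzX
      obtain ⟨x, hx, h0, h1, hmap⟩ := (hφ u y huy).exists_triangle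
      refine ⟨x, hx, Set.mem_iUnion₂.mpr ⟨0, 1, ?_⟩, φ u y, hmap, hPz⟩
      change (z : HyperbolicSpace n) ∈ geodesicSegment (x 0 : HyperbolicSpace n) (x 1)
      rw [h0, h1]
      exact hz
  · have hκ : 0 ≤ 2 * c * Real.log 3 := by nlinarith
    have hclose : ∀ z : quasiConvexHull X, ∃ u y : X,
        IsCloseOnSegment (2 * (2 * c * Real.log 3)) (u : HyperbolicSpace n) y z (p u) (p y)
          (P z) := by
      intro z
      by_cases hzX : (z : HyperbolicSpace n) ∈ X
      · refine ⟨⟨z, hzX⟩, ⟨z, hzX⟩, left_mem_geodesicSegment _ _, ?_, ?_, ?_⟩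
        · rw [← hPX ⟨z, hzX⟩]
          exact left_mem_geodesicSegment _ _
        all_goals
          rw [← hPX ⟨z, hzX⟩]
          simpa using hκ
      · obtain ⟨u, y, huy, hz, hPz⟩ := hPe z hzX
        exact ⟨u, y, hPz ▸ (hφ u y huy).isClose z hz⟩
    have hp : ∀ u y : X, |dist (p u) (p y) - dist (u : HyperbolicSpace n) y| ≤
        2 * c * Real.log 3 := by
      intro u y
      have h1 : dist (p u) (p y) ≤ dist (u : HyperbolicSpace n) y := h.dist_le u y
      have h2 : dist (u : HyperbolicSpace n) y - 2 * c * Real.log 3 ≤ dist (p u) (p y) :=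
        h.le_dist u y
      rw [abs_le]
      constructor <;> linarith
    obtain ⟨u, u', h1⟩ := hclose z
    obtain ⟨v, v', h2⟩ := hclose w
    have := abs_dist_sub_dist_le_of_isCloseOnSegment S h1 h2 (hp u v) (hp u v') (hp u' v) (hp u' v')
    refine this.trans ?_
    nlinarith

end HullMap

/-! ### The tree of an ultrametric Gromov product -/

/-- Two points which both lie between any two of `u`, `v`, `w` agree in a space that satisfies the
four-point inequality with constant `0`. -/
theorem median_unique {T : Type*} [MetricSpace T]
    (h4 : ∀ x y z w : T, dist x y + dist z w ≤ max (dist x z + dist y w) (dist x w + dist y z))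
    {u v w o o' : T} (h₁ : o ∈ geodesicSegment u v) (h₂ : o ∈ geodesicSegment v w)
    (h₃ : o ∈ geodesicSegment w u) (h₁' : o' ∈ geodesicSegment u v)
    (h₂' : o' ∈ geodesicSegment v w) (h₃' : o' ∈ geodesicSegment w u) : o = o' := by
  simp only [mem_geodesicSegment_iff] at *
  have h := h4 o o' u v
  have := dist_comm o u
  have := dist_comm o v
  have := dist_comm o w
  have := dist_comm o' u
  have := dist_comm o' v
  have := dist_comm o' w
  rcases le_max_iff.mp h with h | h <;> exact dist_le_zero.mp (by linarith)

/-- A Gromov product at a base point `root`, subject to the inequality which characterizes trees.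
The distance of `x` to the base point is `val x x`. -/
structure TreeProduct (ι : Type) where
  val : ι → ι → ℝ
  symm : ∀ x y, val x y = val y x
  nonneg : ∀ x y, 0 ≤ val x y
  le_self : ∀ x y, val x y ≤ val x x
  ultra : ∀ x y z, min (val x z) (val z y) ≤ val x y
  root : ι
  root_self : val root root = 0

namespace TreeProduct

variable {ι : Type} (G : TreeProduct ι)

/-- The disjoint union of the segments `[0, val x x]`, which become the segments from the base point
to `x` in the tree. -/
structure Branches where
  index : ι
  height : ℝ
  nonneg : 0 ≤ height
  le_val : height ≤ G.val index index

/-- The Gromov product of two points of the tree: the height at which their branches part. -/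
noncomputable def meet (a b : G.Branches) : ℝ := min (min a.height b.height) (G.val a.index b.index)

theorem meet_comm (a b : G.Branches) : G.meet a b = G.meet b a := by
  unfold meet
  rw [G.symm, min_comm a.height]

theorem meet_self (a : G.Branches) : G.meet a a = a.height := by
  unfold meet
  rw [min_self, min_eq_left a.le_val]

theorem meet_le_left (a b : G.Branches) : G.meet a b ≤ a.height :=
  (min_le_left _ _).trans (min_le_left _ _)

theorem meet_ultra (a b c : G.Branches) : min (G.meet a c) (G.meet c b) ≤ G.meet a b := by
  have h := G.ultra a.index b.index c.index
  unfold meet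
  simp only [le_min_iff, min_le_iff] at *
  grind

noncomputable instance : PseudoMetricSpace G.Branches where
  dist a b := a.height + b.height - 2 * G.meet a b
  dist_self a := by rw [meet_self]; ring
  dist_comm a b := by rw [meet_comm]; ring
  dist_triangle a b c := by
    have h := G.meet_ultra a c b
    have h1 := G.meet_le_left b a
    have h2 := G.meet_le_left b c
    rw [meet_comm] at h1
    rcases min_le_iff.mp h with h | h <;> linarith

theorem Branches.dist_eq (a b : G.Branches) : dist a b = a.height + b.height - 2 * G.meet a b := rfl

/-- The metric tree of an ultrametric Gromov product: its branches are glued along the segments on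
which they have distance zero. -/
abbrev Tree : Type := SeparationQuotient G.Branches

/-- The point at height `t` on the branch of `x`, with `t` clamped to `[0, val x x]`. -/
noncomputable def pt (x : ι) (t : ℝ) : G.Tree :=
  SeparationQuotient.mk ⟨x, max 0 (min t (G.val x x)), le_max_left _ _,
    max_le (G.nonneg x x) (min_le_right _ _)⟩

variable {G}

theorem mk_eq_pt (a : G.Branches) : SeparationQuotient.mk a = G.pt a.index a.height := by
  unfold pt
  simp only [min_eq_left a.le_val, max_eq_right a.nonneg]

theorem exists_eq_pt (a : G.Tree) : ∃ x t, 0 ≤ t ∧ t ≤ G.val x x ∧ a = G.pt x t := by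
  obtain ⟨a, rfl⟩ := SeparationQuotient.surjective_mk a
  exact ⟨a.index, a.height, a.nonneg, a.le_val, mk_eq_pt a⟩

theorem dist_pt {x y : ι} {t s : ℝ} (ht : 0 ≤ t) (ht' : t ≤ G.val x x) (hs : 0 ≤ s)
    (hs' : s ≤ G.val y y) :
    dist (G.pt x t) (G.pt y s) = t + s - 2 * min (min t s) (G.val x y) := by
  unfold pt
  rw [SeparationQuotient.dist_mk, Branches.dist_eq]
  unfold meet
  simp only [min_eq_left ht', min_eq_left hs', max_eq_right ht, max_eq_right hs]

theorem dist_pt_same {x : ι} {t s : ℝ} (ht : 0 ≤ t) (ht' : t ≤ G.val x x) (hs : 0 ≤ s)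
    (hs' : s ≤ G.val x x) : dist (G.pt x t) (G.pt x s) = |t - s| := by
  rw [dist_pt ht ht' hs hs', min_eq_left ((min_le_left _ _).trans ht')]
  rcases le_total t s with h | h
  · rw [min_eq_left h, abs_of_nonpos (by linarith)]; ring
  · rw [min_eq_right h, abs_of_nonneg (by linarith)]; ring

theorem pt_eq_pt {x y : ι} {t : ℝ} (ht : 0 ≤ t) (h : t ≤ G.val x y) : G.pt x t = G.pt y t := by
  have h1 := h.trans (G.le_self x y)
  have h2 : t ≤ G.val y y := by
    rw [G.symm] at h
    exact h.trans (G.le_self y x)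
  apply dist_eq_zero.mp
  rw [dist_pt ht h1 ht h2, min_self, min_eq_left h]
  ring

theorem four_point (x y z w : G.Tree) :
    dist x y + dist z w ≤ max (dist x z + dist y w) (dist x w + dist y z) := by
  obtain ⟨x, rfl⟩ := SeparationQuotient.surjective_mk x
  obtain ⟨y, rfl⟩ := SeparationQuotient.surjective_mk y
  obtain ⟨z, rfl⟩ := SeparationQuotient.surjective_mk z
  obtain ⟨w, rfl⟩ := SeparationQuotient.surjective_mk w
  simp only [SeparationQuotient.dist_mk, Branches.dist_eq]
  have h1 := G.meet_ultra x y z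
  have h2 := G.meet_ultra x y w
  have h3 := G.meet_ultra z w x
  have h4 := G.meet_ultra z w y
  rw [G.meet_comm z x] at h3
  rw [G.meet_comm z y] at h1 h4
  rw [G.meet_comm w y] at h2
  rw [le_max_iff]
  simp only [min_le_iff] at h1 h2 h3 h4
  by_contra! hcon
  rcases h1 with h1 | h1 <;> rcases h2 with h2 | h2 <;> rcases h3 with h3 | h3 <;>
    rcases h4 with h4 | h4 <;> linarith

theorem geodesic (a b : G.Tree) : ∃ γ : ℝ → G.Tree, γ 0 = a ∧ γ (dist a b) = b ∧
    ∀ r ∈ Set.Icc 0 (dist a b), ∀ r' ∈ Set.Icc 0 (dist a b), dist (γ r) (γ r') = |r - r'| := by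
  obtain ⟨x, t, ht, ht', rfl⟩ := exists_eq_pt a
  obtain ⟨y, s, hs, hs', rfl⟩ := exists_eq_pt b
  rw [dist_pt ht ht' hs hs']
  set m := min (min t s) (G.val x y) with hm
  have hmt : m ≤ t := (min_le_left _ _).trans (min_le_left _ _)
  have hms : m ≤ s := (min_le_left _ _).trans (min_le_right _ _)
  have hmG : m ≤ G.val x y := min_le_right _ _
  have hm0 : 0 ≤ m := le_min (le_min ht hs) (G.nonneg x y)
  refine ⟨fun r => if r ≤ t - m then G.pt x (t - r) else G.pt y (2 * m - t + r), ?_, ?_, ?_⟩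
  · simp [hmt]
  · by_cases h : t + s - 2 * m ≤ t - m
    · have : s = m := by linarith
      dsimp only
      rw [if_pos h, this]
      have e : t - (t + m - 2 * m) = m := by ring
      rw [e]
      exact pt_eq_pt hm0 hmG
    · dsimp only
      rw [if_neg h]
      congr 1
      ring
  · have mixed : ∀ r r', 0 ≤ r → r ≤ t - m → ¬ r' ≤ t - m → r' ≤ t + s - 2 * m →
        dist (G.pt x (t - r)) (G.pt y (2 * m - t + r')) = r' - r := by
      intro r r' h0 h1 h2 h3
      rw [dist_pt (by linarith) (by linarith) (by linarith) (by linarith)]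
      have : min (min (t - r) (2 * m - t + r')) (G.val x y) = m := by
        refine le_antisymm ?_ (le_min (le_min (by linarith) (by linarith)) hmG)
        rw [hm]
        refine le_min (le_min ?_ ?_) (min_le_right _ _)
        · exact (min_le_left _ _).trans ((min_le_left _ _).trans (by linarith))
        · exact (min_le_left _ _).trans ((min_le_right _ _).trans (by linarith))
      rw [this]
      ring
    rintro r ⟨hr0, hr1⟩ r' ⟨hr0', hr1'⟩
    dsimp only
    split_ifs with h h' h'
    · rw [dist_pt_same (by linarith) (by linarith) (by linarith) (by linarith), abs_sub_comm]
      congr 1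
      ring
    · rw [mixed r r' hr0 h h' hr1', abs_sub_comm, abs_of_nonneg (by linarith)]
    · rw [dist_comm, mixed r' r hr0' h' h hr1, abs_of_nonneg (by linarith)]
    · rw [dist_pt_same (by linarith) (by linarith) (by linarith) (by linarith)]
      congr 1
      ring

/-- The median of three points is the branch point of the two whose branches part last. -/
theorem median_eq_pt {x y z : ι} {t s r : ℝ} (ht : 0 ≤ t) (ht' : t ≤ G.val x x) (hs : 0 ≤ s)
    (hs' : s ≤ G.val y y) (hr : 0 ≤ r) (hr' : r ≤ G.val z z)
    (h1 : min (min s r) (G.val y z) ≤ min (min t s) (G.val x y))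
    (h2 : min (min t r) (G.val x z) ≤ min (min t s) (G.val x y)) {o : G.Tree}
    (ho1 : o ∈ geodesicSegment (G.pt x t) (G.pt y s))
    (ho2 : o ∈ geodesicSegment (G.pt y s) (G.pt z r))
    (ho3 : o ∈ geodesicSegment (G.pt z r) (G.pt x t)) :
    o = G.pt x (min (min t s) (G.val x y)) := by
  have u1 := G.meet_ultra ⟨x, t, ht, ht'⟩ ⟨z, r, hr, hr'⟩ ⟨y, s, hs, hs'⟩
  have u2 := G.meet_ultra ⟨y, s, hs, hs'⟩ ⟨z, r, hr, hr'⟩ ⟨x, t, ht, ht'⟩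
  rw [G.meet_comm ⟨y, s, hs, hs'⟩ ⟨x, t, ht, ht'⟩] at u2
  unfold meet at u1 u2
  dsimp only at u1 u2
  have u3 : min (min s r) (G.val y z) = min (min t r) (G.val x z) := by
    rw [min_eq_right h1] at u1
    rw [min_eq_right h2] at u2
    exact le_antisymm u1 u2
  set m := min (min t s) (G.val x y) with hm
  have hmt : m ≤ t := (min_le_left _ _).trans (min_le_left _ _)
  have hms : m ≤ s := (min_le_left _ _).trans (min_le_right _ _)
  have hmG : m ≤ G.val x y := min_le_right _ _
  have hm0 : 0 ≤ m := le_min (le_min ht hs) (G.nonneg x y)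
  have e : min (min m r) (G.val x z) = min (min t r) (G.val x z) := by
    refine le_antisymm (min_le_min_right _ (min_le_min_right _ hmt)) ?_
    exact le_min (le_min h2 ((min_le_left _ _).trans (min_le_right _ _))) (min_le_right _ _)
  have d1 : dist (G.pt x t) (G.pt x m) = t - m := by
    rw [dist_pt_same ht ht' hm0 (hmt.trans ht'), abs_of_nonneg (by linarith)]
  have d2 : dist (G.pt x m) (G.pt y s) = s - m := by
    rw [dist_pt hm0 (hmt.trans ht') hs hs', min_eq_left hms, min_eq_left hmG]
    ring
  have d3 : dist (G.pt x m) (G.pt z r) = m + r - 2 * min (min t r) (G.val x z) := by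
    rw [dist_pt hm0 (hmt.trans ht') hr hr', e]
  have c3 := dist_comm (G.pt x m) (G.pt z r)
  have c2 := dist_comm (G.pt x m) (G.pt y s)
  have c1 := dist_comm (G.pt x t) (G.pt x m)
  have c4 := dist_comm (G.pt x t) (G.pt z r)
  have f1 := dist_pt (G := G) ht ht' hs hs'
  have f2 := dist_pt (G := G) hs hs' hr hr'
  have f3 := dist_pt (G := G) ht ht' hr hr'
  refine median_unique four_point ho1 ho2 ho3 ?_ ?_ ?_ <;> rw [mem_geodesicSegment_iff] <;>
    linarith

open Classical in
/-- The structure of finite metric tree: the vertices are the end points of the branches and the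
points where two branches part. -/
noncomputable def finiteMetricTree [Fintype ι] (G : TreeProduct ι) : FiniteMetricTree G.Tree where
  geodesic := geodesic
  four_point := four_point
  vertices := Finset.univ.image fun e : ι × ι => G.pt e.1 (G.val e.1 e.2)
  spanned a := by
    obtain ⟨x, t, ht, ht', rfl⟩ := exists_eq_pt a
    have h0 : G.val x G.root = 0 := le_antisymm
      (by rw [G.symm, ← G.root_self]; exact G.le_self _ _) (G.nonneg _ _)
    refine ⟨G.pt x (G.val x G.root), Finset.mem_image_of_mem _ (Finset.mem_univ (x, G.root)),
      G.pt x (G.val x x), Finset.mem_image_of_mem _ (Finset.mem_univ (x, x)), ?_⟩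
    rw [h0, mem_geodesicSegment_iff, dist_pt_same le_rfl (G.nonneg _ _) ht ht',
      dist_pt_same ht ht' (G.nonneg _ _) le_rfl,
      dist_pt_same le_rfl (G.nonneg _ _) (G.nonneg _ _) le_rfl, abs_of_nonpos (by linarith),
      abs_of_nonpos (by linarith), abs_of_nonpos (by linarith [G.nonneg x x])]
    ring
  branch := by
    have key : ∀ {x y x' y' : ι}, G.pt x (min (min (G.val x x') (G.val y y')) (G.val x y)) ∈
        Finset.univ.image fun e : ι × ι => G.pt e.1 (G.val e.1 e.2) := by
      intro x y x' y'
      rw [Finset.mem_image]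
      rcases min_choice (min (G.val x x') (G.val y y')) (G.val x y) with h | h
      · rcases min_choice (G.val x x') (G.val y y') with h' | h'
        · exact ⟨(x, x'), Finset.mem_univ _, by rw [h, h']⟩
        · refine ⟨(y, y'), Finset.mem_univ _, ?_⟩
          rw [h, h']
          refine (pt_eq_pt (G.nonneg _ _) ?_).symm
          rw [← h', ← h]
          exact min_le_right _ _
      · exact ⟨(x, y), Finset.mem_univ _, by rw [h]⟩
    intro u hu v hv w hw o h1 h2 h3
    obtain ⟨⟨x, x'⟩, -, rfl⟩ := Finset.mem_image.mp hu
    obtain ⟨⟨y, y'⟩, -, rfl⟩ := Finset.mem_image.mp hv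
    obtain ⟨⟨z, z'⟩, -, rfl⟩ := Finset.mem_image.mp hw
    dsimp only at h1 h2 h3
    -- relabel the three vertices so that the branches of the first two part last
    wlog hmax : min (min (G.val y y') (G.val z z')) (G.val y z) ≤
        min (min (G.val x x') (G.val y y')) (G.val x y) ∧
        min (min (G.val x x') (G.val z z')) (G.val x z) ≤
        min (min (G.val x x') (G.val y y')) (G.val x y) generalizing x x' y y' z z'
    · have e1 := min_comm (G.val x x') (G.val y y')
      have e2 := min_comm (G.val x x') (G.val z z')
      have e3 := min_comm (G.val y y') (G.val z z')
      have s1 := G.symm x y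
      have s2 := G.symm x z
      have s3 := G.symm y z
      rcases le_total (min (min (G.val y y') (G.val z z')) (G.val y z))
        (min (min (G.val x x') (G.val z z')) (G.val x z)) with h | h
      · refine this z z' hw x x' hu h3 y y' hv h2 h1 ?_
        rw [← e2, ← s2, ← e3, ← s3]
        refine ⟨?_, h⟩
        by_contra hc
        exact hmax ⟨h.trans (not_le.mp hc).le, (not_le.mp hc).le⟩
      · refine this y y' hv z z' hw h2 x x' hu h1 h3 ?_
        rw [← e2, ← s2, ← e1, ← s1]
        refine ⟨h, ?_⟩
        by_contra hc
        exact hmax ⟨(not_le.mp hc).le, h.trans (not_le.mp hc).le⟩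
    rw [median_eq_pt (G.nonneg _ _) (G.le_self _ _) (G.nonneg _ _) (G.le_self _ _) (G.nonneg _ _)
      (G.le_self _ _) hmax.1 hmax.2 h1 h2 h3]
    exact key

theorem pt_mem_vertices [Fintype ι] (x y : ι) :
    G.pt x (G.val x y) ∈ G.finiteMetricTree.vertices := by
  classical
  exact Finset.mem_image.mpr ⟨(x, y), Finset.mem_univ _, rfl⟩

theorem dist_pt_self (x y : ι) : dist (G.pt x (G.val x x)) (G.pt y (G.val y y)) =
    G.val x x + G.val y y - 2 * G.val x y := by
  rw [dist_pt (G.nonneg _ _) le_rfl (G.nonneg _ _) le_rfl, min_eq_right]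
  refine le_min (G.le_self x y) ?_
  rw [G.symm]
  exact G.le_self y x

theorem leaves_subset [Fintype ι] :
    G.finiteMetricTree.leaves ⊆ Set.range fun x => G.pt x (G.val x x) := by
  classical
  intro v hv
  obtain ⟨⟨x, y⟩, -, rfl⟩ := Finset.mem_image.mp hv.1
  dsimp only at hv ⊢
  have hroot : ∀ z, G.pt z 0 = G.pt G.root (G.val G.root G.root) := fun z => by
    rw [G.root_self]
    exact pt_eq_pt le_rfl (G.nonneg _ _)
  rcases (G.nonneg x y).eq_or_lt with h0 | h0
  · exact ⟨G.root, by rw [← h0, hroot]⟩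
  rcases (G.le_self x y).eq_or_lt with h1 | h1
  · exact ⟨x, by rw [h1]⟩
  have d1 : dist (G.pt x 0) (G.pt x (G.val x y)) = G.val x y := by
    rw [dist_pt_same le_rfl (G.nonneg _ _) h0.le h1.le, abs_of_nonpos (by linarith)]
    ring
  have d2 : dist (G.pt x (G.val x y)) (G.pt x (G.val x x)) = G.val x x - G.val x y := by
    rw [dist_pt_same h0.le h1.le (G.nonneg _ _) le_rfl, abs_of_nonpos (by linarith)]
    ring
  have d3 : dist (G.pt x 0) (G.pt x (G.val x x)) = G.val x x := by
    rw [dist_pt_same le_rfl (G.nonneg _ _) (G.nonneg _ _) le_rfl, abs_of_nonpos (by linarith)]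
    ring
  refine absurd hv (G.finiteMetricTree.notMem_leaves_of_mem_geodesicSegment
    (u := G.pt x 0) (w := G.pt x (G.val x x)) ?_ (pt_mem_vertices _ _) ?_ ?_ ?_)
  · rw [hroot]
    exact pt_mem_vertices _ _
  · exact (dist_pos.mp (d1.symm ▸ h0)).symm
  · exact dist_pos.mp (d2.symm ▸ sub_pos.mpr h1)
  · rw [mem_geodesicSegment_iff, d1, d2, d3]
    ring

end TreeProduct

/-! ### The Gromov approximating tree of a finite set -/

section GromovTree

variable {n : ℕ}

/-- The Gromov product of `x` and `y` at the base point `w`. -/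
noncomputable def gromovProduct (w x y : HyperbolicSpace n) : ℝ :=
  (dist w x + dist w y - dist x y) / 2

theorem gromovProduct_comm (w x y : HyperbolicSpace n) :
    gromovProduct w x y = gromovProduct w y x := by
  unfold gromovProduct
  rw [dist_comm x y]
  ring

theorem gromovProduct_nonneg (w x y : HyperbolicSpace n) : 0 ≤ gromovProduct w x y := by
  have := dist_triangle_left x y w
  unfold gromovProduct
  linarith

theorem gromovProduct_le_left (w x y : HyperbolicSpace n) : gromovProduct w x y ≤ dist w x := by
  have := dist_triangle w x y
  unfold gromovProduct
  linarith

theorem gromovProduct_le_right (w x y : HyperbolicSpace n) : gromovProduct w x y ≤ dist w y := by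
  rw [gromovProduct_comm]
  exact gromovProduct_le_left w y x

theorem gromovProduct_base_left (w y : HyperbolicSpace n) : gromovProduct w w y = 0 := by
  simp [gromovProduct]

theorem gromovProduct_base_right (w x : HyperbolicSpace n) : gromovProduct w x w = 0 := by
  rw [gromovProduct_comm, gromovProduct_base_left]

theorem exp_neg_gromovProduct_le (w x y z : HyperbolicSpace n) :
    Real.exp (-gromovProduct w x y) ≤
      Real.exp (-gromovProduct w x z) + Real.exp (-gromovProduct w z y) := by
  have h := HyperbolicSpace.exp_ptolemy x y z w
  have h' := mul_le_mul_of_nonneg_right h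
    (Real.exp_pos (-(dist w x + dist w y + dist w z) / 2)).le
  rw [add_mul, ← Real.exp_add, ← Real.exp_add, ← Real.exp_add] at h'
  have e1 : (dist x y + dist z w) / 2 + -(dist w x + dist w y + dist w z) / 2 =
      -gromovProduct w x y := by
    rw [gromovProduct, dist_comm z w]
    ring
  have e2 : (dist x z + dist y w) / 2 + -(dist w x + dist w y + dist w z) / 2 =
      -gromovProduct w x z := by
    rw [gromovProduct, dist_comm y w]
    ring
  have e3 : (dist y z + dist x w) / 2 + -(dist w x + dist w y + dist w z) / 2 =
      -gromovProduct w z y := by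
    rw [gromovProduct, dist_comm x w, dist_comm y z]
    ring
  rwa [e1, e2, e3] at h'

variable {X : Finset (HyperbolicSpace n)}

/-- The graph on `X` in which two points are adjacent if their Gromov product is at least `t`. -/
def thresholdGraph (w : X) (t : ℝ) : SimpleGraph X where
  Adj x y := x ≠ y ∧ t ≤ gromovProduct (w : HyperbolicSpace n) x y
  symm := ⟨fun x y h => ⟨h.1.symm, gromovProduct_comm (w : HyperbolicSpace n) x y ▸ h.2⟩⟩
  loopless := ⟨fun _ h => h.1 rfl⟩

theorem exp_neg_gromovProduct_le_of_walk {w : X} {t : ℝ} {x y : X}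
    (q : (thresholdGraph w t).Walk x y) (hxy : x ≠ y) :
    Real.exp (-gromovProduct (w : HyperbolicSpace n) x y) ≤ q.length * Real.exp (-t) := by
  induction q with
  | nil => exact absurd rfl hxy
  | @cons x v y h q ih =>
    have h1 : Real.exp (-gromovProduct (w : HyperbolicSpace n) x v) ≤ Real.exp (-t) :=
      Real.exp_le_exp.mpr (neg_le_neg h.2)
    have h2 := Real.exp_pos (-t)
    rw [SimpleGraph.Walk.length_cons]
    push_cast
    by_cases hvy : v = y
    · subst hvy
      have : 0 ≤ (q.length : ℝ) * Real.exp (-t) := by positivity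
      linarith
    · have h3 := exp_neg_gromovProduct_le (w : HyperbolicSpace n) x y v
      have := ih hvy
      linarith

theorem base_notMem_support {w : X} {t : ℝ} (ht : 0 < t) {x y : X}
    (q : (thresholdGraph w t).Walk x y) (hx : x ≠ w) : w ∉ q.support := by
  induction q with
  | nil => simpa using hx.symm
  | @cons x v y h q ih =>
    rw [SimpleGraph.Walk.support_cons, List.mem_cons, not_or]
    refine ⟨hx.symm, ih ?_⟩
    rintro rfl
    have := h.2
    rw [gromovProduct_base_right] at this
    linarith

theorem three_le_card {w x y : X} (hxy : x ≠ y) (hx : x ≠ w) (hy : y ≠ w) :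
    (3 : ℝ) ≤ X.card := by
  classical
  have h3 : ({x, y, w} : Finset X).card = 3 :=
    Finset.card_eq_three.mpr ⟨x, y, w, hxy, hx, hy, rfl⟩
  have := Finset.card_le_univ ({x, y, w} : Finset X)
  rw [h3, Fintype.card_coe] at this
  exact_mod_cast this

/-- A chain of Gromov products at least `t` from `x` to `y` may be assumed to have at most
`|X| - 2` links, as it need not repeat a point and does not meet the base point. -/
theorem le_gromovProduct_add_log {w : X} {t : ℝ} {x y : X} (hxy : x ≠ y) (hx : x ≠ w)
    (hy : y ≠ w) (h : (thresholdGraph w t).Reachable x y) :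
    t ≤ gromovProduct (w : HyperbolicSpace n) x y + Real.log (X.card - 2) := by
  classical
  have hcard := three_le_card hxy hx hy
  have hpos : (0 : ℝ) < X.card - 2 := by linarith
  have hg := gromovProduct_nonneg (w : HyperbolicSpace n) x y
  rcases le_or_gt t 0 with ht | ht
  · have : 0 ≤ Real.log (X.card - 2) := Real.log_nonneg (by linarith)
    linarith
  obtain ⟨q, hq⟩ := h.exists_isPath
  have hlen : q.length + 2 ≤ X.card := by
    have hsub : q.support.toFinset ⊆ Finset.univ.erase w := by
      intro v hv
      refine Finset.mem_erase.mpr ⟨?_, Finset.mem_univ _⟩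
      rintro rfl
      exact base_notMem_support ht q hx (List.mem_toFinset.mp hv)
    have h1 := Finset.card_le_card hsub
    rw [List.toFinset_card_of_nodup hq.support_nodup, SimpleGraph.Walk.length_support,
      Finset.card_erase_of_mem (Finset.mem_univ _), Finset.card_univ, Fintype.card_coe] at h1
    omega
  have hlen' : (q.length : ℝ) ≤ X.card - 2 := by
    have : ((q.length + 2 : ℕ) : ℝ) ≤ X.card := by exact_mod_cast hlen
    push_cast at this
    linarith
  have h1 := exp_neg_gromovProduct_le_of_walk q hxy
  have h2 : Real.exp (-gromovProduct (w : HyperbolicSpace n) x y) ≤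
      Real.exp (Real.log (X.card - 2) + -t) := by
    rw [Real.exp_add, Real.exp_log hpos]
    exact h1.trans (by gcongr)
  have := Real.exp_le_exp.mp h2
  linarith

/-- The levels `t` at which `x` and `y` are joined by a chain of Gromov products at least `t`. -/
def chainLevels (w x y : X) : Set ℝ :=
  {t | t ≤ dist w x ∧ t ≤ dist w y ∧ (thresholdGraph w t).Reachable x y}

theorem bddAbove_chainLevels (w x y : X) : BddAbove (chainLevels w x y) :=
  ⟨dist w x, fun _ h => h.1⟩

theorem gromovProduct_mem_chainLevels (w x y : X) :
    gromovProduct (w : HyperbolicSpace n) x y ∈ chainLevels w x y := by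
  refine ⟨gromovProduct_le_left _ _ _, gromovProduct_le_right _ _ _, ?_⟩
  by_cases h : x = y
  · exact h ▸ SimpleGraph.Reachable.refl x
  · exact SimpleGraph.Adj.reachable ⟨h, le_rfl⟩

theorem chainLevels_comm (w x y : X) : chainLevels w x y = chainLevels w y x := by
  ext t
  exact ⟨fun h => ⟨h.2.1, h.1, h.2.2.symm⟩, fun h => ⟨h.2.1, h.1, h.2.2.symm⟩⟩

theorem mem_chainLevels_of_le {w x y : X} {s t : ℝ} (hst : s ≤ t) (h : t ∈ chainLevels w x y) :
    s ∈ chainLevels w x y :=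
  ⟨hst.trans h.1, hst.trans h.2.1,
    h.2.2.mono fun x y (e : (thresholdGraph w t).Adj x y) => ⟨e.1, hst.trans e.2⟩⟩

theorem sSup_chainLevels_self (w x : X) : sSup (chainLevels w x x) = dist w x :=
  le_antisymm (csSup_le ⟨_, gromovProduct_mem_chainLevels w x x⟩ fun _ h => h.1)
    (le_csSup (bddAbove_chainLevels w x x) ⟨le_rfl, le_rfl, SimpleGraph.Reachable.refl x⟩)

/-- The largest level at which `x` and `y` are joined by a chain, as a Gromov product. -/
noncomputable def chainProduct (w : X) : TreeProduct X where
  val x y := sSup (chainLevels w x y)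
  symm x y := by rw [chainLevels_comm]
  nonneg x y := (gromovProduct_nonneg _ _ _).trans
    (le_csSup (bddAbove_chainLevels w x y) (gromovProduct_mem_chainLevels w x y))
  le_self x y := by
    rw [sSup_chainLevels_self]
    exact csSup_le ⟨_, gromovProduct_mem_chainLevels w x y⟩ fun _ h => h.1
  ultra x y z := by
    refine le_of_forall_lt fun t ht => ?_
    obtain ⟨h1, h2⟩ := lt_min_iff.mp ht
    obtain ⟨t1, m1, l1⟩ := exists_lt_of_lt_csSup ⟨_, gromovProduct_mem_chainLevels w x z⟩ h1
    obtain ⟨t2, m2, l2⟩ := exists_lt_of_lt_csSup ⟨_, gromovProduct_mem_chainLevels w z y⟩ h2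
    have k1 := mem_chainLevels_of_le (min_le_left t1 t2) m1
    have k2 := mem_chainLevels_of_le (min_le_right t1 t2) m2
    exact (lt_min l1 l2).trans_le
      (le_csSup (bddAbove_chainLevels w x y) ⟨k1.1, k2.2.1, k1.2.2.trans k2.2.2⟩)
  root := w
  root_self := by rw [sSup_chainLevels_self, dist_self]

theorem chainProduct_self (w x : X) : (chainProduct w).val x x = dist w x :=
  sSup_chainLevels_self w x

theorem gromovProduct_le_chainProduct (w x y : X) :
    gromovProduct (w : HyperbolicSpace n) x y ≤ (chainProduct w).val x y :=
  le_csSup (bddAbove_chainLevels w x y) (gromovProduct_mem_chainLevels w x y)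

theorem chainProduct_le {c : ℝ} (hc : 0 < c) (hX : (X.card : ℝ) ≤ (2 : ℝ) ^ c + 2) (w x y : X) :
    (chainProduct w).val x y ≤ gromovProduct (w : HyperbolicSpace n) x y + c * Real.log 3 := by
  have hlog2 := Real.log_pos one_lt_two
  have hlog : Real.log 2 ≤ Real.log 3 := Real.log_le_log two_pos (by norm_num)
  have hle : c * Real.log 2 ≤ c * Real.log 3 := by gcongr
  have h0 : 0 ≤ c * Real.log 2 := by positivity
  refine csSup_le ⟨_, gromovProduct_mem_chainLevels w x y⟩ fun t ht => ?_
  have hg := gromovProduct_nonneg (w : HyperbolicSpace n) x y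
  by_cases hxw : x = w
  · have h1 := ht.1
    rw [hxw, dist_self] at h1
    linarith
  by_cases hyw : y = w
  · have h1 := ht.2.1
    rw [hyw, dist_self] at h1
    linarith
  by_cases hxy : x = y
  · have h1 : t ≤ dist (w : HyperbolicSpace n) x := ht.1
    subst hxy
    have : gromovProduct (w : HyperbolicSpace n) x x = dist (w : HyperbolicSpace n) x := by
      simp [gromovProduct]
    linarith
  have h1 := le_gromovProduct_add_log hxy hxw hyw ht.2.2
  have h2 : Real.log (X.card - 2) ≤ c * Real.log 2 := by
    rw [← Real.log_rpow two_pos]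
    exact Real.log_le_log (by linarith [three_le_card hxy hxw hyw]) (by linarith)
  linarith

theorem isGromovApproximatingTree_chainProduct (w : X) {c : ℝ} (hc : 0 < c)
    (hX : (X.card : ℝ) ≤ (2 : ℝ) ^ c + 2) :
    IsGromovApproximatingTree c X (chainProduct w).finiteMetricTree
      fun x => (chainProduct w).pt x ((chainProduct w).val x x) where
  map_vertices x := TreeProduct.pt_mem_vertices x x
  leaves_subset := TreeProduct.leaves_subset
  le_dist x y := by
    have h := chainProduct_le hc hX w x y
    rw [TreeProduct.dist_pt_self, chainProduct_self, chainProduct_self]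
    unfold gromovProduct at h
    simp only [Subtype.dist_eq]
    linarith
  dist_le x y := by
    have h := gromovProduct_le_chainProduct w x y
    rw [TreeProduct.dist_pt_self, chainProduct_self, chainProduct_self]
    unfold gromovProduct at h
    simp only [Subtype.dist_eq]
    linarith

end GromovTree

theorem mainTheorem3 (n : ℕ) (X : Finset (HyperbolicSpace n)) (hX : X.Nonempty) :
    -- There is a finite metric tree, a Gromov approximating tree, quasi-isometric to the hull.
    (∃ (T : Type) (_ : MetricSpace T) (S : FiniteMetricTree T) (p : X → T),
      ∀ c : ℝ, 0 < c → (X.card : ℝ) ≤ (2 : ℝ) ^ c + 2 →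
        IsGromovApproximatingTree c X S p ∧
        ∃ P : quasiConvexHull X → T, IsQuasiIsometry 1 ((20 * c + 12) * Real.log 3) P) ∧
    -- For every Gromov approximating tree and every edge `[ab]` of the hull there is such a map.
    (∀ c : ℝ, 0 < c → (X.card : ℝ) ≤ (2 : ℝ) ^ c + 2 →
      ∀ (T : Type u) [MetricSpace T] (S : FiniteMetricTree T) (p : X → T),
        IsGromovApproximatingTree c X S p →
        ∀ a ∈ X, ∀ b ∈ X, ∃ P : quasiConvexHull X → T,
          ContinuousOn P {z | (z : HyperbolicSpace n) ∈ geodesicSegment a b} ∧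
          (∀ z : quasiConvexHull X, ∃ x : Fin 3 → X,
            ((∃ x' : Fin 3 → X, IsNondegenerate x') → IsNondegenerate x) ∧
            (z : HyperbolicSpace n) ∈ triangle (fun i => (x i : HyperbolicSpace n)) ∧
            ∃ φ : HyperbolicSpace n → T,
              IsTriangleMap (fun i => (x i : HyperbolicSpace n)) (fun i => p (x i)) φ ∧
              P z = φ z) ∧
          (∀ x : X, P ⟨x, mem_quasiConvexHull x⟩ = p x) ∧
          (∀ v ∈ S.vertices, v ∈ Set.range P) ∧
          IsQuasiIsometry 1 ((20 * c + 12) * Real.log 3) P) := by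
  obtain ⟨w, hw⟩ := hX
  refine ⟨⟨(chainProduct (⟨w, hw⟩ : X)).Tree, inferInstance,
    (chainProduct (⟨w, hw⟩ : X)).finiteMetricTree,
    fun x => (chainProduct (⟨w, hw⟩ : X)).pt x ((chainProduct ⟨w, hw⟩).val x x), fun c hc hcard => ?_⟩, ?_⟩
  · have h := isGromovApproximatingTree_chainProduct (⟨w, hw⟩ : X) hc hcard
    obtain ⟨P, -, -, -, -, hP⟩ := h.exists_hullMap hc ⟨w, hw⟩ ⟨w, hw⟩
    exact ⟨h, P, hP⟩
  · intro c hc _ T _ S p h a ha b hb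
    obtain ⟨P, h1, h2, h3, h4, h5⟩ := h.exists_hullMap hc ⟨a, ha⟩ ⟨b, hb⟩
    exact ⟨P, h1, h2, h3, fun v _ => h4 v, h5⟩
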